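/- Let $y_t=x_t+\sigma\zeta_t$, where $x\in\mathbb C^{\mathbb Z}$ is unknown, $\sigma\ge 0$, and $\zeta_t=\xi^1_t+i\xi^2_t$ with all $\xi^1_t,\xi^2_t$ independent standard real normal variables. A constrained least-squares filter on $[-N,N]$ is given by integers $a\le b$, $0\le k\le m$ with $-N\le a-(m-k)$, $b+k\le N$ and a real number $\varrho\ge1$, all fixed in advance: it is an optimal solution $\widehat\varphi$, supported on $[-k,m-k]$, of $$\min_{\varphi}\Big\{\sum_{t=a}^{b}|y_t-[\varphi*y]_t|^2:\ \sum_{l=0}^{m}\Big|\frac1{\sqrt{m+1}}\sum_{j=0}^m\varphi_{j-k}e^{2\pi i lj/(m+1)}\Big|\le\frac{\varrho}{\sqrt{m+1}}\Big\},$$ and it estimates $x_t$, $a\le t\le b$, by $[\widehat\varphi*y]_t$. An estimator combines $J$ such filters if at each point $t\in[-N,N]$ it equals the estimate given by one of the $J$ filters whose window $[a,b]$ contains $t$, the choice of this filter being fixed in advance. Put $\mathrm{MSE}=\mathbf E\sum_{|t|\le N}|x_t-\widehat x_t|^2$. There is an absolute constant $C>0$, and for every $u>1$ a constant $C_u>0$,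 such that for all integers $N\ge0$, $s\ge1$ there is a measurable estimator $\widehat x$ (a function of $(y_t)_{|t|\le N}$ which may depend on $N,s,u$, but not on $x$ or $\sigma$), combining at most $C\ln(N+2)$ constrained least-squares filters, with the following properties for all $\sigma\ge0$. (i) For every generalized harmonic oscillation with $s$ frequencies counted with multiplicity, i.e. $x_t=\sum_{k}\sum_{0\le j<m_k}c_{kj}t^je^{2\pi i f_kt}$ with real $f_k$, complex $c_{kj}$ and $\sum_k m_k=s$, $$\mathrm{MSE}\le C\sigma^2s^3\ln^2(N+2).$$ (ii) For every harmonic oscillation $x_t=\sum_{k=1}^sc_ke^{2\pi i f_kt}$ with well-separated frequencies, i.e. such that $N\,\delta(f_k-f_l)\ge u$, where $\delta(\cdot)$ is the distance to the nearest integer, for all $k\ne l$, $$\mathrm{MSE}\le C_u\sigma^2s^2\ln^2(N+2).$$ -/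

import Mathlib

open MeasureTheory ProbabilityTheory

/-- Two-sided complex-valued sequences. -/
abbrev Signal : Type := ℤ → ℂ

/-- The law of `ξ₁ + i ξ₂` with `ξ₁, ξ₂` independent real standard normal variables. -/
noncomputable def stdComplexGaussian : Measure ℂ :=
  ((gaussianReal 0 1).prod (gaussianReal 0 1)).map
    (fun p : ℝ × ℝ => (p.1 : ℂ) + (p.2 : ℂ) * Complex.I)

/-- `ζ` is an i.i.d. sequence of standard complex Gaussian variables. -/
def IsStdComplexNoise {Ω : Type*} [MeasurableSpace Ω] (P : Measure Ω) (ζ : ℤ → Ω → ℂ) : Prop :=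
  (∀ t, HasLaw (ζ t) stdComplexGaussian P) ∧ iIndepFun ζ P

/-- The unitary discrete Fourier transform on `ℂ^(m+1)`. -/
noncomputable def dftU {m : ℕ} (z : Fin (m + 1) → ℂ) (l : Fin (m + 1)) : ℂ :=
  ((Real.sqrt (m + 1) : ℝ) : ℂ)⁻¹ *
    ∑ t : Fin (m + 1),
      z t * Complex.exp (2 * Real.pi * Complex.I * ((l : ℕ) : ℂ) * ((t : ℕ) : ℂ) / ((m : ℂ) + 1))

/-- The convolution `[φ * y]_t = ∑_τ φ_τ y_{t-τ}` for a filter `φ` supported on `[-k, m-k]`,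
where `φ` is given by the vector `c` of its coefficients, `φ_{j-k} = c_j` for `0 ≤ j ≤ m`. -/
noncomputable def filterApply {m : ℕ} (k : ℕ) (c : Fin (m + 1) → ℂ) (y : Signal) (t : ℤ) : ℂ :=
  ∑ j : Fin (m + 1), c j * y (t - (((j : ℕ) : ℤ) - (k : ℤ)))

/-- The parameters of a constrained least-squares filter: the filter is supported on
`[-k, m-k]` (`k = 0`: left filter, `k = m`: right filter), it is fitted to the observations on
`[left, right]`, and the norm of its Fourier transform is bounded through `rho`. -/
structure LSProblem where
  left : ℤ
  right : ℤ
  m : ℕ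
  k : ℕ
  rho : ℝ

namespace LSProblem

/-- The problem makes sense and involves only the observations on `[-N, N]`. -/
def Admissible (w : LSProblem) (N : ℕ) : Prop :=
  w.left ≤ w.right ∧ w.k ≤ w.m ∧ 1 ≤ w.rho ∧
    -(N : ℤ) ≤ w.left - ((w.m : ℤ) - (w.k : ℤ)) ∧ w.right + (w.k : ℤ) ≤ (N : ℤ)

/-- The constraint: the `ℓ₁`-norm of the Fourier transform is at most `rho / √(m+1)`. -/
def Feasible (w : LSProblem) (c : Fin (w.m + 1) → ℂ) : Prop :=
  ∑ l : Fin (w.m + 1), ‖dftU c l‖ ≤ w.rho / Real.sqrt (w.m + 1)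

/-- The least-squares criterion `∑_{left ≤ t ≤ right} |y_t - [φ * y]_t|²`. -/
noncomputable def residual (w : LSProblem) (y : Signal) (c : Fin (w.m + 1) → ℂ) : ℝ :=
  ∑ t ∈ Finset.Icc w.left w.right, ‖y t - filterApply w.k c y t‖ ^ 2

/-- `c` is an optimal solution of the constrained least-squares problem for the data `y`. -/
def IsSolution (w : LSProblem) (y : Signal) (c : Fin (w.m + 1) → ℂ) : Prop :=
  w.Feasible c ∧ ∀ c', w.Feasible c' → w.residual y c ≤ w.residual y c'

end LSProblem

/-- `xhat` combines `J` constrained least-squares filters on `[-N, N]`: the problems `w i` and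
the assignment `piece` of points to problems are fixed in advance, `φ i y` is an optimal solution
of the `i`-th problem for the data `y`, and at each point `t` of `[-N, N]` the estimate of the
signal is the output of the filter number `piece t`, one of those fitted on a window
containing `t`. -/
def CombinesLSFilters (N J : ℕ) (xhat : Signal → Signal) : Prop :=
  ∃ (w : Fin J → LSProblem) (piece : Set.Icc (-(N : ℤ)) (N : ℤ) → Fin J)
    (φ : (i : Fin J) → Signal → (Fin ((w i).m + 1) → ℂ)),
    (∀ i, (w i).Admissible N) ∧
    (∀ i y, (w i).IsSolution y (φ i y)) ∧
    (∀ t : Set.Icc (-(N : ℤ)) (N : ℤ),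
      (t : ℤ) ∈ Set.Icc (w (piece t)).left (w (piece t)).right) ∧
    (∀ (y : Signal) (t : Set.Icc (-(N : ℤ)) (N : ℤ)),
      xhat y (t : ℤ) = filterApply (w (piece t)).k (φ (piece t) y) y (t : ℤ))

/-- An estimator of the signal from the observations `y_t`, `|t| ≤ N`. -/
def IsEstimator (N : ℕ) (xhat : Signal → Signal) : Prop :=
  Measurable xhat ∧ DependsOn xhat (Set.Icc (-(N : ℤ)) (N : ℤ))

/-- The observations `y_t = x_t + σ ζ_t`. -/
noncomputable def observe (x : Signal) (σ : ℝ) (z : Signal) : Signal :=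
  fun t => x t + (σ : ℂ) * z t

/-- The mean squared error `E ∑_{|t| ≤ N} |x_t - x̂_t|²`. -/
noncomputable def totalMSE {Ω : Type*} [MeasurableSpace Ω] (P : Measure Ω) (N : ℕ)
    (xhat : Signal → Signal) (x : Signal) (σ : ℝ) (ζ : ℤ → Ω → ℂ) : ENNReal :=
  ∫⁻ ω, ∑ t ∈ Finset.Icc (-(N : ℤ)) (N : ℤ),
    ‖x t - xhat (observe x σ (fun r => ζ r ω)) t‖ₑ ^ 2 ∂P

/-- Generalized harmonic oscillations with `s` frequencies counted with multiplicity: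
`x_t = ∑_k ∑_{j < mult k} c_{kj} t^j exp(2π i f_k t)` with real `f_k` and `∑_k mult k = s`. -/
def IsGenHarmonicOscillation (s : ℕ) (x : Signal) : Prop :=
  ∃ (r : ℕ) (f : Fin r → ℝ) (mult : Fin r → ℕ) (c : Fin r → ℕ → ℂ),
    ∑ k, mult k = s ∧
    ∀ t : ℤ, x t = ∑ k, ∑ j ∈ Finset.range (mult k),
      c k j * (t : ℂ) ^ j * Complex.exp (2 * Real.pi * Complex.I * (f k : ℂ) * (t : ℂ))

/-- Harmonic oscillations `x_t = ∑_{k=1}^s c_k exp(2π i f_k t)` whose frequencies are separated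
by at least `u / N` in the wrap-around distance of `ℝ / ℤ`. -/
def IsSeparatedHarmonicOscillation (u : ℝ) (N s : ℕ) (x : Signal) : Prop :=
  ∃ (f : Fin s → ℝ) (c : Fin s → ℂ),
    (∀ i j, i ≠ j → u ≤ (N : ℝ) * ‖((f i - f j : ℝ) : UnitAddCircle)‖) ∧
    ∀ t : ℤ, x t = ∑ k, c k * Complex.exp (2 * Real.pi * Complex.I * (f k : ℂ) * (t : ℂ))

/-!
A generalized harmonic oscillation lies in a shift-invariant space `V` of dimension at most `s`.
Among `n + 1` consecutive points there is one at which the reproducing kernel of `V` has squared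
norm at most `s / (n + 1)`, so by shift invariance a filter `ψ` of width `n` with this energy
reproduces all of `V`; the Fourier transform of `ψ * ψ` then has the small `ℓ₁` norm which makes
`ψ * ψ` feasible.

Comparing the least-squares solution with this oracle bounds its error on a window by three
functionals of the noise: the energy of the filtered noise, its correlation with the noise, and the
projection of the noise to `V`. Feasible filters are combinations of Fourier modes of bounded total
weight, so the first two are maxima over `m + 1` modes, which costs a factor `log (m + 1)` only.
The correlation is quadratic in the noise: its part inside the window is a square of a linear form,
and the rest is linear in the noise on the window conditionally on the noise outside.

Symmetric filters fit into `[-N, N]` only up to the distance to its end points, whence `O(log N)`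
dyadic windows, each with an error of order `σ² s² log N`.
-/

section MeanBounds

/-- The mean of the positive part of `f` is at most `b`. Being stated with the lower Lebesgue
integral, it needs no separate integrability proofs. -/
def MeanLE {Ω : Type*} [MeasurableSpace Ω] (P : Measure Ω) (f : Ω → ℝ) (b : ℝ) : Prop :=
  AEMeasurable f P ∧ ∫⁻ ω, ENNReal.ofReal (f ω) ∂P ≤ ENNReal.ofReal b

namespace MeanLE

variable {Ω ι : Type*} [MeasurableSpace Ω] {P : Measure Ω} {f g : Ω → ℝ} {b c : ℝ}

lemma mono (h : MeanLE P f b) (hbc : b ≤ c) : MeanLE P f c :=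
  ⟨h.1, h.2.trans (ENNReal.ofReal_le_ofReal hbc)⟩

lemma of_le (h : MeanLE P f b) (hg : AEMeasurable g P) (hgf : ∀ ω, g ω ≤ f ω) : MeanLE P g b :=
  ⟨hg, (lintegral_mono fun ω => ENNReal.ofReal_le_ofReal (hgf ω)).trans h.2⟩

lemma add (hf : MeanLE P f b) (hg : MeanLE P g c) (hb : 0 ≤ b) (hc : 0 ≤ c) :
    MeanLE P (fun ω => f ω + g ω) (b + c) := by
  refine ⟨hf.1.add hg.1, ?_⟩
  calc ∫⁻ ω, ENNReal.ofReal (f ω + g ω) ∂P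
      ≤ ∫⁻ ω, (ENNReal.ofReal (f ω) + ENNReal.ofReal (g ω)) ∂P :=
        lintegral_mono fun ω => ENNReal.ofReal_add_le
    _ = ∫⁻ ω, ENNReal.ofReal (f ω) ∂P + ∫⁻ ω, ENNReal.ofReal (g ω) ∂P :=
        lintegral_add_left' hf.1.ennreal_ofReal _
    _ ≤ ENNReal.ofReal (b + c) := by
        rw [ENNReal.ofReal_add hb hc]
        exact add_le_add hf.2 hg.2

lemma const_mul (hf : MeanLE P f b) {a : ℝ} (ha : 0 ≤ a) :
    MeanLE P (fun ω => a * f ω) (a * b) := by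
  refine ⟨hf.1.const_mul a, ?_⟩
  simp_rw [ENNReal.ofReal_mul ha]
  rw [lintegral_const_mul' _ _ ENNReal.ofReal_ne_top]
  gcongr
  exact hf.2

lemma const [IsProbabilityMeasure P] (a : ℝ) : MeanLE P (fun _ => a) a :=
  ⟨aemeasurable_const, by simp⟩

lemma sum {F : ι → Ω → ℝ} {b : ι → ℝ} (s : Finset ι) (h : ∀ i ∈ s, MeanLE P (F i) (b i))
    (hb : ∀ i ∈ s, 0 ≤ b i) : MeanLE P (fun ω => ∑ i ∈ s, F i ω) (∑ i ∈ s, b i) := by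
  classical
  induction s using Finset.induction_on with
  | empty => exact ⟨by simp, by simp⟩
  | insert i s hi ih =>
    simp_rw [Finset.sum_insert hi]
    have hb' : ∀ j ∈ s, 0 ≤ b j := fun j hj => hb j (Finset.mem_insert_of_mem hj)
    exact (h i (Finset.mem_insert_self _ _)).add
      (ih (fun j hj => h j (Finset.mem_insert_of_mem hj)) hb')
      (hb i (Finset.mem_insert_self _ _)) (Finset.sum_nonneg hb')

lemma exists_upperBound [IsProbabilityMeasure P] [Fintype ι] [Nonempty ι] {X : ι → Ω → ℝ}
    (hc : 0 ≤ c) (h : ∀ l, MeanLE P (fun ω => Real.exp (X l ω)) c) :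
    ∃ Y : Ω → ℝ, MeanLE P Y (Real.log (Fintype.card ι) + c) ∧ ∀ ω l, X l ω ≤ Y ω := by
  set M : ℝ := (Fintype.card ι : ℝ)
  have hM_pos : 0 < M := Nat.cast_pos.2 Fintype.card_pos
  refine ⟨fun ω => Real.log M + M⁻¹ * ∑ l, Real.exp (X l ω), ?_, fun ω l => ?_⟩
  · refine ((const (Real.log M)).add ((sum Finset.univ (fun l _ => h l) fun _ _ => hc).const_mul
      (inv_nonneg.2 hM_pos.le)) (Real.log_natCast_nonneg _) (by positivity)).mono ?_
    rw [Finset.sum_const, Finset.card_univ, nsmul_eq_mul, inv_mul_cancel_left₀ hM_pos.ne']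
  · have tangent_line : X l ω - Real.log M + 1 ≤ M⁻¹ * Real.exp (X l ω) := by
      have := Real.add_one_le_exp (X l ω - Real.log M)
      rwa [Real.exp_sub, Real.exp_log hM_pos, div_eq_inv_mul] at this
    have exp_le_sum : Real.exp (X l ω) ≤ ∑ l, Real.exp (X l ω) :=
      Finset.single_le_sum (f := fun l => Real.exp (X l ω)) (fun _ _ => (Real.exp_pos _).le)
        (Finset.mem_univ l)
    have := mul_le_mul_of_nonneg_left exp_le_sum (inv_nonneg.2 hM_pos.le)
    linarith

end MeanLE

end MeanBounds

section GaussianNoise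

lemma lintegral_exp_sq_div_gaussianReal_le (v : NNReal) :
    ∫⁻ x, ENNReal.ofReal (Real.exp (x ^ 2 / (4 * v))) ∂(gaussianReal 0 v) ≤ 2 := by
  rcases eq_or_ne v 0 with rfl | hv
  · simp
  have hv_pos : (0 : ℝ) < v := by exact_mod_cast pos_iff_ne_zero.2 hv
  set D : ℝ → ℝ := fun x =>
    (Real.sqrt (2 * Real.pi * v))⁻¹ * Real.exp (-(1 / (4 * (v : ℝ))) * x ^ 2)
  have hD : Integrable D := (integrable_exp_neg_mul_sq (by positivity)).const_mul _
  have density_mul_exp (x : ℝ) :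
      (gaussianPDF 0 v * fun x => ENNReal.ofReal (Real.exp (x ^ 2 / (4 * v)))) x =
        ENNReal.ofReal (D x) := by
    rw [Pi.mul_apply, gaussianPDF_def, ← ENNReal.ofReal_mul (gaussianPDFReal_nonneg _ _ _),
      gaussianPDFReal_def, mul_assoc, ← Real.exp_add]
    congr 3
    field_simp
    ring
  rw [gaussianReal_of_var_ne_zero 0 hv,
    lintegral_withDensity_eq_lintegral_mul _ (measurable_gaussianPDF 0 v) (by fun_prop),
    lintegral_congr density_mul_exp,
    ← ofReal_integral_eq_lintegral_ofReal hD (.of_forall fun x => by positivity),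
    integral_const_mul, integral_gaussian, ← ENNReal.ofReal_ofNat 2]
  refine ENNReal.ofReal_le_ofReal ?_
  rw [inv_mul_le_iff₀ (by positivity), Real.sqrt_le_left (by positivity), mul_pow,
    Real.sq_sqrt (by positivity)]
  field_simp
  norm_num

lemma map_re_mul_stdComplexGaussian (a : ℂ) :
    stdComplexGaussian.map (fun z => (a * z).re) = gaussianReal 0 (‖a‖₊ ^ 2) := by
  set γ := (gaussianReal 0 1).prod (gaussianReal 0 1)
  have hfst : HasLaw Prod.fst (gaussianReal 0 1) γ := ⟨by fun_prop, by simp [γ]⟩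
  have hsnd : HasLaw Prod.snd (gaussianReal 0 1) γ := ⟨by fun_prop, by simp [γ]⟩
  have law_fst := gaussianReal_const_mul hfst a.re
  have law_snd := gaussianReal_const_mul hsnd (-a.im)
  have indep : IndepFun (fun p : ℝ × ℝ => a.re * p.1) (fun p : ℝ × ℝ => -a.im * p.2) γ :=
    indepFun_prod (by fun_prop) (by fun_prop)
  have re_mul : ((fun z : ℂ => (a * z).re) ∘ fun p : ℝ × ℝ => (p.1 : ℂ) + (p.2 : ℂ) * Complex.I) =
      (fun p : ℝ × ℝ => a.re * p.1) + (fun p : ℝ × ℝ => -a.im * p.2) := by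
    ext p
    simp only [Function.comp_apply, Complex.mul_re, Complex.add_re, Complex.ofReal_re,
      Complex.mul_im, Complex.I_re, Complex.I_im, Complex.ofReal_im, Complex.add_im, Pi.add_apply]
    ring
  rw [stdComplexGaussian, Measure.map_map (by fun_prop) (by fun_prop), re_mul,
    gaussianReal_add_gaussianReal_of_indepFun indep law_fst.map_eq law_snd.map_eq]
  congr 1
  · simp
  · ext
    simp only [NNReal.coe_add, NNReal.coe_mul, NNReal.coe_mk, NNReal.coe_one, NNReal.coe_pow,
      coe_nnnorm, Complex.sq_norm, Complex.normSq_apply]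
    ring

variable {Ω ι : Type*} [MeasurableSpace Ω] {P : Measure Ω} {ζ : ℤ → Ω → ℂ}

lemma IsStdComplexNoise.aemeasurable (hζ : IsStdComplexNoise P ζ) (t : ℤ) :
    AEMeasurable (ζ t) P :=
  (hζ.1 t).aemeasurable

variable [IsProbabilityMeasure P]

lemma lintegral_comp_prodMk_le_of_indepFun {α β : Type*} [MeasurableSpace α] [MeasurableSpace β]
    {X : Ω → α} {Y : Ω → β} (hX : AEMeasurable X P) (hY : AEMeasurable Y P) (hXY : IndepFun X Y P)
    {G : α × β → ENNReal} (hG : Measurable G) {b : ENNReal}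
    (hb : ∀ x, ∫⁻ ω, G (x, Y ω) ∂P ≤ b) : ∫⁻ ω, G (X ω, Y ω) ∂P ≤ b := by
  have := Measure.isProbabilityMeasure_map hX
  have := Measure.isProbabilityMeasure_map hY
  calc ∫⁻ ω, G (X ω, Y ω) ∂P
      = ∫⁻ x, ∫⁻ y, G (x, y) ∂P.map Y ∂P.map X := by
        rw [← lintegral_prod _ hG.aemeasurable, ← hXY.map_prod_eq_prod_map_map hX hY,
          lintegral_map' hG.aemeasurable (hX.prodMk hY)]
    _ ≤ ∫⁻ _, b ∂P.map X := lintegral_mono fun x => by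
        rw [lintegral_map' (by fun_prop) hY]
        exact hb x
    _ = b := by simp

namespace IsStdComplexNoise

lemma hasLaw_re_sum (hζ : IsStdComplexNoise P ζ) (F : Finset ℤ) (a : ℤ → ℂ) :
    HasLaw (fun ω => ∑ r ∈ F, (a r * ζ r ω).re) (gaussianReal 0 (∑ r ∈ F, ‖a r‖₊ ^ 2)) P := by
  have hm (r : ℤ) : AEMeasurable (fun ω => (a r * ζ r ω).re) P :=
    Complex.measurable_re.comp_aemeasurable ((hζ.aemeasurable r).const_mul _)
  have indep : iIndepFun (fun r ω => (a r * ζ r ω).re) P :=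
    hζ.2.comp (fun r z => (a r * z).re) fun r => by fun_prop
  induction F using Finset.induction_on with
  | empty => exact ⟨by simp, by simp⟩
  | insert i s hi ih =>
    have law_i : HasLaw (fun ω => (a i * ζ i ω).re) (gaussianReal 0 (‖a i‖₊ ^ 2)) P :=
      HasLaw.comp (X := ζ i) (Y := fun z => (a i * z).re)
        ⟨by fun_prop, map_re_mul_stdComplexGaussian _⟩ (hζ.1 i)
    have indep_i : IndepFun (fun ω => (a i * ζ i ω).re) (fun ω => ∑ r ∈ s, (a r * ζ r ω).re) P := by
      have := (indep.indepFun_finsetSum_of_notMem₀ hm hi).symm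
      rwa [Finset.sum_fn] at this
    refine ⟨Finset.aemeasurable_fun_sum _ fun r _ => hm r, ?_⟩
    simp_rw [Finset.sum_insert hi]
    rw [← zero_add (0 : ℝ),
      ← gaussianReal_add_gaussianReal_of_indepFun indep_i law_i.map_eq ih.map_eq]
    rfl

lemma meanLE_exp_re_sq (hζ : IsStdComplexNoise P ζ) (F : Finset ℤ) (a : ℤ → ℂ) :
    MeanLE P (fun ω => Real.exp ((∑ r ∈ F, a r * ζ r ω).re ^ 2 / (4 * ∑ r ∈ F, ‖a r‖ ^ 2))) 2 := by
  have law := hζ.hasLaw_re_sum F a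
  simp_rw [Complex.re_sum]
  refine ⟨by have := law.aemeasurable; fun_prop, ?_⟩
  have := lintegral_exp_sq_div_gaussianReal_le (∑ r ∈ F, ‖a r‖₊ ^ 2)
  rw [← law.lintegral_comp (by fun_prop)] at this
  simpa using this

/-- For vanishing coefficients this holds because `0 / 0 = 0`. -/
lemma meanLE_exp_norm_sq (hζ : IsStdComplexNoise P ζ) (F : Finset ℤ) (a : ℤ → ℂ) :
    MeanLE P (fun ω => Real.exp (‖∑ r ∈ F, a r * ζ r ω‖ ^ 2 / (8 * ∑ r ∈ F, ‖a r‖ ^ 2))) 2 := by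
  have re_bound := hζ.meanLE_exp_re_sq F a
  have im_bound := hζ.meanLE_exp_re_sq F fun r => -Complex.I * a r
  refine (((re_bound.add im_bound (by norm_num) (by norm_num)).const_mul
    (a := 1 / 2) (by norm_num)).of_le ?_ fun ω => ?_).mono (by norm_num)
  · have := hζ.aemeasurable
    fun_prop
  simp_rw [mul_assoc, ← Finset.mul_sum, norm_mul, norm_neg, Complex.norm_I, one_mul]
  set S := ∑ r ∈ F, a r * ζ r ω
  set v := ∑ r ∈ F, ‖a r‖ ^ 2
  have re_rotate : (-Complex.I * S).re = S.im := by simp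
  have exp_norm : Real.exp (‖S‖ ^ 2 / (8 * v)) =
      Real.exp (S.re ^ 2 / (8 * v)) * Real.exp (S.im ^ 2 / (8 * v)) := by
    rw [← Real.exp_add, Complex.sq_norm, Complex.normSq_apply]
    ring_nf
  have exp_four (x : ℝ) : Real.exp (x ^ 2 / (4 * v)) = Real.exp (x ^ 2 / (8 * v)) ^ 2 := by
    rw [← Real.exp_nat_mul]
    push_cast
    ring_nf
  rw [re_rotate, exp_norm, exp_four, exp_four]
  linarith [two_mul_le_add_sq (Real.exp (S.re ^ 2 / (8 * v))) (Real.exp (S.im ^ 2 / (8 * v)))]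

/-- Integrating first over the block `F` reduces this to deterministic coefficients. -/
lemma meanLE_exp_norm_sq_of_disjoint (hζ : IsStdComplexNoise P ζ) {F F' : Finset ℤ}
    (hF : Disjoint F' F) {a : Signal → ℤ → ℂ} (ha : ∀ r, Measurable fun z => a z r)
    (ha' : DependsOn a F') :
    MeanLE P (fun ω => Real.exp (‖∑ r ∈ F, a (fun i => ζ i ω) r * ζ r ω‖ ^ 2 /
      (8 * ∑ r ∈ F, ‖a (fun i => ζ i ω) r‖ ^ 2))) 2 := by
  have hm := hζ.aemeasurable
  have hm' : AEMeasurable (fun ω i => ζ i ω) P := aemeasurable_pi_lambda _ hm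
  refine ⟨?_, ?_⟩
  · have (r : ℤ) : AEMeasurable (fun ω => a (fun i => ζ i ω) r) P := (ha r).comp_aemeasurable hm'
    fun_prop
  set extend : (F' → ℂ) → Signal := Function.updateFinset (0 : Signal) F'
  have extend_measurable : Measurable extend := measurable_updateFinset
  set G : (F' → ℂ) × (F → ℂ) → ENNReal := fun p =>
    ENNReal.ofReal (Real.exp (‖∑ r : F, a (extend p.1) r * p.2 r‖ ^ 2 /
      (8 * ∑ r : F, ‖a (extend p.1) r‖ ^ 2)))
  have hG : Measurable G := by
    have (r : ℤ) : Measurable fun p : (F' → ℂ) × (F → ℂ) => a (extend p.1) r :=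
      (ha r).comp (extend_measurable.comp measurable_fst)
    fun_prop
  have a_extend (z : Signal) : a (extend (F'.restrict z)) = a z :=
    ha' fun i hi => by simp [extend, Function.updateFinset, Finset.mem_coe.1 hi]
  have sum_noise (c : ℤ → ℂ) (ω : Ω) : ∑ r : F, c r * ζ r ω = ∑ r ∈ F, c r * ζ r ω :=
    Finset.sum_coe_sort F fun r => c r * ζ r ω
  have key := lintegral_comp_prodMk_le_of_indepFun (b := ENNReal.ofReal 2)
    (X := fun ω (i : F') => ζ i ω) (Y := fun ω (i : F) => ζ i ω)
    (aemeasurable_pi_lambda _ fun i => hm i) (aemeasurable_pi_lambda _ fun i => hm i)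
    (hζ.2.indepFun_finset₀ F' F hF hm) hG fun x => by
      have := (hζ.meanLE_exp_norm_sq F (a (extend x))).2
      simpa only [G, sum_noise, Finset.sum_coe_sort F fun r => ‖a (extend x) r‖ ^ 2] using this
  refine le_of_eq_of_le (lintegral_congr fun ω => ?_) key
  have := a_extend fun i => ζ i ω
  rw [Finset.restrict_def] at this
  simp only [G, this, sum_noise, Finset.sum_coe_sort F fun r => ‖a (fun i => ζ i ω) r‖ ^ 2]

end IsStdComplexNoise

lemma norm_sum_mul_sq_le_of_div_le {F : Finset ι} {a z : ι → ℂ} {b : ℝ}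
    (h : ‖∑ r ∈ F, a r * z r‖ ^ 2 / (8 * ∑ r ∈ F, ‖a r‖ ^ 2) ≤ b) :
    ‖∑ r ∈ F, a r * z r‖ ^ 2 ≤ 8 * b * ∑ r ∈ F, ‖a r‖ ^ 2 := by
  rcases (show 0 ≤ ∑ r ∈ F, ‖a r‖ ^ 2 by positivity).eq_or_lt with hzero | hpos
  · have a_zero : ∀ r ∈ F, a r = 0 := by
      simpa using (Finset.sum_eq_zero_iff_of_nonneg fun r _ => by positivity).1 hzero.symm
    have : ∑ r ∈ F, a r * z r = 0 := Finset.sum_eq_zero fun r hr => by simp [a_zero r hr]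
    simp [this, ← hzero]
  · rw [div_le_iff₀ (by positivity)] at h
    linarith

namespace IsStdComplexNoise

lemma meanLE_norm_sq (hζ : IsStdComplexNoise P ζ) (F : Finset ℤ) (a : ℤ → ℂ) :
    MeanLE P (fun ω => ‖∑ r ∈ F, a r * ζ r ω‖ ^ 2) (16 * ∑ r ∈ F, ‖a r‖ ^ 2) := by
  refine (((hζ.meanLE_exp_norm_sq F a).const_mul (a := 8 * ∑ r ∈ F, ‖a r‖ ^ 2)
    (by positivity)).of_le ?_ fun ω => ?_).mono (by linarith)
  · have := hζ.aemeasurable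
    fun_prop
  · refine (norm_sum_mul_sq_le_of_div_le
      ((le_add_of_nonneg_right zero_le_one).trans (Real.add_one_le_exp _))).trans_eq (by ring)

lemma exists_norm_sq_le_of_disjoint (hζ : IsStdComplexNoise P ζ) [Fintype ι] [Nonempty ι]
    {F F' : Finset ℤ} (hF : Disjoint F' F) {a : ι → Signal → ℤ → ℂ}
    (ha : ∀ l r, Measurable fun z => a l z r) (ha' : ∀ l, DependsOn (a l) F') :
    ∃ Y : Ω → ℝ, MeanLE P Y (8 * (Real.log (Fintype.card ι) + 2)) ∧
      ∀ ω, 0 ≤ Y ω ∧ ∀ l, ‖∑ r ∈ F, a l (fun i => ζ i ω) r * ζ r ω‖ ^ 2 ≤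
        Y ω * ∑ r ∈ F, ‖a l (fun i => ζ i ω) r‖ ^ 2 := by
  obtain ⟨Y, hY, hle⟩ := MeanLE.exists_upperBound (by norm_num) fun l =>
    hζ.meanLE_exp_norm_sq_of_disjoint hF (ha l) (ha' l)
  refine ⟨fun ω => 8 * Y ω, hY.const_mul (by norm_num),
    fun ω => ⟨?_, fun l => norm_sum_mul_sq_le_of_div_le (hle ω l)⟩⟩
  have : 0 ≤ Y ω := le_trans (by positivity) (hle ω (Classical.arbitrary ι))
  positivity

lemma exists_norm_sq_le (hζ : IsStdComplexNoise P ζ) [Fintype ι] [Nonempty ι]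
    (F : Finset ℤ) (a : ι → ℤ → ℂ) :
    ∃ Y : Ω → ℝ, MeanLE P Y (8 * (Real.log (Fintype.card ι) + 2)) ∧
      ∀ ω, 0 ≤ Y ω ∧ ∀ l, ‖∑ r ∈ F, a l r * ζ r ω‖ ^ 2 ≤ Y ω * ∑ r ∈ F, ‖a l r‖ ^ 2 :=
  hζ.exists_norm_sq_le_of_disjoint (Finset.disjoint_empty_left F) (a := fun l _ => a l)
    (fun _ _ => measurable_const) fun _ _ _ _ => rfl

end IsStdComplexNoise

end GaussianNoise

section ShiftInvariantSpaces

/-- Restriction of signals to the finite window `F`, with the Euclidean norm. -/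
noncomputable def window (F : Finset ℤ) : Signal →ₗ[ℂ] EuclideanSpace ℂ F :=
  (WithLp.linearEquiv 2 ℂ (F → ℂ)).symm.toLinearMap ∘ₗ LinearMap.funLeft ℂ ℂ (fun t : F => (t : ℤ))

lemma window_apply (F : Finset ℤ) (x : Signal) (t : F) : window F x t = x t := rfl

lemma norm_sq_window (F : Finset ℤ) (x : Signal) : ‖window F x‖ ^ 2 = ∑ t ∈ F, ‖x t‖ ^ 2 := by
  simp_rw [EuclideanSpace.norm_sq_eq, window_apply, Finset.sum_coe_sort F fun t => ‖x t‖ ^ 2]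

lemma inner_window (F : Finset ℤ) (x y : Signal) :
    inner ℂ (window F x) (window F y) = ∑ t ∈ F, starRingEnd ℂ (x t) * y t := by
  simp_rw [PiLp.inner_apply, window_apply, RCLike.inner_apply, mul_comm (y _),
    Finset.sum_coe_sort F fun t => starRingEnd ℂ (x t) * y t]

lemma exists_orthonormal_window (V : Submodule ℂ Signal) [FiniteDimensional ℂ V] (F : Finset ℤ) :
    ∃ (d : ℕ) (b : Fin d → Signal), d ≤ Module.finrank ℂ V ∧
      Orthonormal ℂ (fun i => window F (b i)) ∧
      ∀ x ∈ V, window F x = ∑ i, inner ℂ (window F (b i)) (window F x) • window F (b i) := by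
  set e := stdOrthonormalBasis ℂ (V.map (window F))
  choose b hb using fun i => (e i).2
  have window_b : (fun i => window F (b i)) = fun i => (e i : EuclideanSpace ℂ F) :=
    funext fun i => (hb i).2
  refine ⟨_, b, Submodule.finrank_map_le _ _, ?_, fun x hx => ?_⟩
  · rw [window_b]
    exact e.orthonormal.comp_linearIsometry (V.map (window F)).subtypeₗᵢ
  · simpa [(hb _).2] using
      (congrArg Subtype.val (e.sum_repr' ⟨window F x, Submodule.mem_map_of_mem hx⟩)).symm

lemma exists_reproducing_point (V : Submodule ℂ Signal) [FiniteDimensional ℂ V] {F : Finset ℤ}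
    (hF : F.Nonempty) :
    ∃ t ∈ F, ∃ g : Signal, ‖window F g‖ ^ 2 ≤ (Module.finrank ℂ V : ℝ) / F.card ∧
      ∀ x ∈ V, inner ℂ (window F g) (window F x) = x t := by
  obtain ⟨d, b, hd, hb, expansion⟩ := exists_orthonormal_window V F
  obtain ⟨t, ht, hle⟩ : ∃ t ∈ F, ∑ i, ‖b i t‖ ^ 2 ≤ (Module.finrank ℂ V : ℝ) / F.card := by
    refine Finset.exists_le_of_sum_le hF ?_
    rw [Finset.sum_comm]
    simp_rw [← norm_sq_window, hb.norm_eq_one]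
    have : (F.card : ℝ) ≠ 0 := Nat.cast_ne_zero.2 (Finset.card_ne_zero.2 hF)
    simpa [mul_div_cancel₀ _ this] using hd
  refine ⟨t, ht, ∑ i, starRingEnd ℂ (b i t) • b i, ?_, fun x hx => ?_⟩ <;>
    simp_rw [map_sum, map_smul]
  · rw [← @inner_self_eq_norm_sq ℂ, hb.inner_sum]
    simpa [Complex.mul_conj', ← Complex.ofReal_pow, mul_comm] using hle
  · calc inner ℂ (∑ i, starRingEnd ℂ (b i t) • window F (b i)) (window F x)
        = (∑ i, inner ℂ (window F (b i)) (window F x) • window F (b i)).ofLp ⟨t, ht⟩ := by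
          simp [window_apply, mul_comm]
      _ = x t := by rw [← expansion x hx, window_apply]

/-- The space of signals `V` is invariant under all shifts. -/
def ShiftInvariant (V : Submodule ℂ Signal) : Prop :=
  ∀ x ∈ V, ∀ d : ℤ, (fun t => x (t + d)) ∈ V

lemma ShiftInvariant.exists_reproducing {V : Submodule ℂ Signal} [FiniteDimensional ℂ V]
    (hV : ShiftInvariant V) (n : ℕ) :
    ∃ (S : Finset ℤ) (ψ : Signal), S ⊆ Finset.Icc (-(n : ℤ)) n ∧
      ∑ τ ∈ S, ‖ψ τ‖ ^ 2 ≤ Module.finrank ℂ V / (n + 1) ∧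
      ∀ x ∈ V, ∀ t, ∑ τ ∈ S, ψ τ * x (t - τ) = x t := by
  obtain ⟨j, hj, g, hg, hrep⟩ := exists_reproducing_point V (F := Finset.Icc (0 : ℤ) n) (by simp)
  refine ⟨(Finset.Icc (0 : ℤ) n).map (Equiv.subLeft j).toEmbedding,
    fun τ => starRingEnd ℂ (g (j - τ)), ?_, ?_, fun x hx t => ?_⟩
  · intro τ hτ
    simp only [Finset.mem_map_equiv, Equiv.subLeft_symm_apply, Finset.mem_Icc] at hτ hj ⊢
    omega
  · rw [norm_sq_window] at hg
    simpa using hg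
  · have := hrep _ (hV x hx (t - j))
    rw [inner_window, add_sub_cancel] at this
    rw [← this, Finset.sum_map]
    refine Finset.sum_congr rfl fun r _ => ?_
    simp only [Equiv.coe_toEmbedding, Equiv.subLeft_apply, sub_sub_cancel]
    congr 2
    ring

/-- `B` is the squared norm of the projection of the noise to the restrictions of `V`. -/
lemma IsStdComplexNoise.exists_projection_bound {Ω : Type*} [MeasurableSpace Ω] {P : Measure Ω}
    [IsProbabilityMeasure P] {ζ : ℤ → Ω → ℂ} (hζ : IsStdComplexNoise P ζ)
    (V : Submodule ℂ Signal) [FiniteDimensional ℂ V] (F : Finset ℤ) :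
    ∃ B : Ω → ℝ, MeanLE P B (16 * Module.finrank ℂ V) ∧ ∀ ω, 0 ≤ B ω ∧ ∀ x ∈ V,
      ‖inner ℂ (window F fun t => ζ t ω) (window F x)‖ ^ 2 ≤ B ω * ‖window F x‖ ^ 2 := by
  obtain ⟨d, b, hd, hb, expansion⟩ := exists_orthonormal_window V F
  refine ⟨fun ω => ∑ i, ‖inner ℂ (window F (b i)) (window F fun t => ζ t ω)‖ ^ 2, ?_,
    fun ω => ⟨by positivity, fun x hx => ?_⟩⟩
  · have unit_energy (i : Fin d) : ∑ t ∈ F, ‖b i t‖ ^ 2 = 1 := by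
      simp_rw [← norm_sq_window, hb.norm_eq_one, one_pow]
    have coordinate (i : Fin d) := hζ.meanLE_norm_sq F fun t => starRingEnd ℂ (b i t)
    simp_rw [inner_window]
    refine (MeanLE.sum Finset.univ (fun i _ => coordinate i) fun _ _ => by positivity).mono ?_
    simpa [unit_energy, mul_comm (16 : ℝ)] using hd
  · set z := window F fun t => ζ t ω
    calc ‖inner ℂ z (window F x)‖ ^ 2
        = ‖∑ i, inner ℂ (window F (b i)) (window F x) * inner ℂ z (window F (b i))‖ ^ 2 := by
          conv_lhs => rw [expansion x hx]
          simp_rw [inner_sum, inner_smul_right]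
      _ ≤ (∑ i, ‖inner ℂ (window F (b i)) z‖ * ‖inner ℂ (window F (b i)) (window F x)‖) ^ 2 := by
          gcongr
          refine (norm_sum_le _ _).trans_eq (Finset.sum_congr rfl fun i _ => ?_)
          rw [norm_mul, norm_inner_symm z, mul_comm]
      _ ≤ (∑ i, ‖inner ℂ (window F (b i)) z‖ ^ 2) *
            ∑ i, ‖inner ℂ (window F (b i)) (window F x)‖ ^ 2 :=
          Finset.sum_mul_sq_le_sq_mul_sq _ _ _
      _ ≤ _ := by
          gcongr
          exact hb.sum_inner_products_le _

end ShiftInvariantSpaces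

section HarmonicOscillations

lemma shiftInvariant_span {S : Set Signal}
    (hS : ∀ x ∈ S, ∀ d : ℤ, (fun t => x (t + d)) ∈ Submodule.span ℂ S) :
    ShiftInvariant (Submodule.span ℂ S) := by
  intro x hx d
  have : Submodule.span ℂ S ≤
      (Submodule.span ℂ S).comap (LinearMap.funLeft ℂ ℂ fun t : ℤ => t + d) :=
    Submodule.span_le.2 fun y hy => hS y hy d
  exact this hx

/-- The signal `t ↦ t^j exp(2π i f t)`, a building block of generalized harmonic oscillations. -/
noncomputable def expMonomial (f : ℝ) (j : ℕ) : Signal := fun t =>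
  (t : ℂ) ^ j * Complex.exp (2 * Real.pi * Complex.I * (f : ℂ) * (t : ℂ))

lemma expMonomial_shift (f : ℝ) (j : ℕ) (d : ℤ) :
    (fun t => expMonomial f j (t + d)) = ∑ i ∈ Finset.range (j + 1),
      ((d : ℂ) ^ (j - i) * (j.choose i : ℂ) *
        Complex.exp (2 * Real.pi * Complex.I * (f : ℂ) * (d : ℂ))) • expMonomial f i := by
  ext t
  simp only [expMonomial, Finset.sum_apply, Pi.smul_apply, smul_eq_mul]
  push_cast
  rw [add_pow, mul_add, Complex.exp_add, Finset.sum_mul]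
  exact Finset.sum_congr rfl fun i _ => by ring

lemma IsGenHarmonicOscillation.exists_shiftInvariant {s : ℕ} {x : Signal}
    (hx : IsGenHarmonicOscillation s x) :
    ∃ V : Submodule ℂ Signal, FiniteDimensional ℂ V ∧ Module.finrank ℂ V ≤ s ∧
      ShiftInvariant V ∧ x ∈ V := by
  obtain ⟨r, f, mult, c, hs, hx⟩ := hx
  set e : (Σ k : Fin r, Fin (mult k)) → Signal := fun p => expMonomial (f p.1) p.2
  have mem_span (k : Fin r) {j : ℕ} (hj : j < mult k) :
      expMonomial (f k) j ∈ Submodule.span ℂ (Set.range e) :=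
    Submodule.subset_span ⟨⟨k, ⟨j, hj⟩⟩, rfl⟩
  refine ⟨Submodule.span ℂ (Set.range e), FiniteDimensional.span_of_finite ℂ (Set.finite_range e),
    (finrank_range_le_card e).trans_eq (by simp [hs]), shiftInvariant_span ?_, ?_⟩
  · rintro _ ⟨⟨k, j⟩, rfl⟩ d
    rw [expMonomial_shift]
    refine Submodule.sum_mem _ fun i hi => Submodule.smul_mem _ _ (mem_span k ?_)
    exact (Nat.lt_succ_iff.1 (Finset.mem_range.1 hi)).trans_lt j.2
  · have expansion : x = ∑ k, ∑ j ∈ Finset.range (mult k), c k j • expMonomial (f k) j := by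
      ext t
      simp only [hx, expMonomial, Finset.sum_apply, Pi.smul_apply, smul_eq_mul, mul_assoc]
    rw [expansion]
    exact Submodule.sum_mem _ fun k _ => Submodule.sum_mem _ fun j hj =>
      Submodule.smul_mem _ _ (mem_span k (Finset.mem_range.1 hj))

lemma IsSeparatedHarmonicOscillation.isGenHarmonicOscillation {u : ℝ} {N s : ℕ} {x : Signal}
    (hx : IsSeparatedHarmonicOscillation u N s x) : IsGenHarmonicOscillation s x := by
  obtain ⟨f, c, -, hx⟩ := hx
  exact ⟨s, f, fun _ => 1, fun k _ => c k, by simp, fun t => by simp [hx]⟩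

end HarmonicOscillations

section Fourier

/-- The character `r ↦ exp(2πi l r / (m + 1))`, the `l`-th Fourier mode of period `m + 1`. -/
noncomputable def mode (m : ℕ) (l : Fin (m + 1)) (r : ℤ) : ℂ :=
  ZMod.stdAddChar (((l : ℕ) : ZMod (m + 1)) * (r : ZMod (m + 1)))

variable {m : ℕ}

lemma mode_add (l : Fin (m + 1)) (p q : ℤ) : mode m l (p + q) = mode m l p * mode m l q := by
  simp only [mode, Int.cast_add, mul_add, AddChar.map_add_eq_mul]

lemma norm_mode (l : Fin (m + 1)) (r : ℤ) : ‖mode m l r‖ = 1 :=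
  AddChar.norm_apply _ _

lemma conj_mode (l : Fin (m + 1)) (r : ℤ) : starRingEnd ℂ (mode m l r) = mode m l (-r) := by
  simp only [mode, Int.cast_neg, mul_neg, AddChar.map_neg_eq_conj]

lemma sum_mode {d : ℤ} (hd : |d| ≤ m) :
    ∑ l : Fin (m + 1), mode m l d = if d = 0 then (m : ℂ) + 1 else 0 := by
  have zero_iff : (d : ZMod (m + 1)) = 0 ↔ d = 0 := by
    rw [ZMod.intCast_zmod_eq_zero_iff_dvd]
    refine ⟨fun h => Int.eq_zero_of_abs_lt_dvd h ?_, fun h => h ▸ dvd_zero _⟩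
    push_cast
    omega
  have full_sum := AddChar.sum_mulShift (d : ZMod (m + 1)) (ZMod.isPrimitive_stdAddChar (m + 1))
  simp only [zero_iff, ZMod.card, Nat.cast_ite, Nat.cast_succ, Nat.cast_zero] at full_sum
  rw [← full_sum]
  exact Finset.sum_congr rfl fun l _ => congrArg (fun a => ZMod.stdAddChar (a * (d : ZMod (m + 1))))
    (ZMod.natCast_zmod_val (n := m + 1) l)

lemma dftU_eq_sum_mode (c : Fin (m + 1) → ℂ) (l : Fin (m + 1)) :
    dftU c l = ((Real.sqrt (m + 1) : ℝ) : ℂ)⁻¹ * ∑ j : Fin (m + 1), c j * mode m l (j : ℕ) := by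
  rw [dftU]
  congr 1
  refine Finset.sum_congr rfl fun j _ => ?_
  have := ZMod.stdAddChar_coe (N := m + 1) ((l : ℕ) * (j : ℕ))
  push_cast at this
  rw [mode, Int.cast_natCast, this]
  simp only [mul_assoc]

/-- The Fourier transform as a linear map. -/
noncomputable def dftUₗ (m : ℕ) : (Fin (m + 1) → ℂ) →ₗ[ℂ] Fin (m + 1) → ℂ where
  toFun := dftU
  map_add' c c' := by
    funext l
    simp only [dftU, Pi.add_apply, add_mul, Finset.sum_add_distrib, mul_add]
  map_smul' a c := by
    funext l
    simp only [dftU, Pi.smul_apply, smul_eq_mul, Finset.mul_sum, RingHom.id_apply]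
    exact Finset.sum_congr rfl fun j _ => by ring

/-- The output of a filter as a linear function of its coefficients. -/
noncomputable def filterApplyₗ (m k : ℕ) (y : Signal) : (Fin (m + 1) → ℂ) →ₗ[ℂ] Signal where
  toFun c := filterApply k c y
  map_add' c c' := by
    funext t
    simp only [filterApply, Pi.add_apply, add_mul, Finset.sum_add_distrib]
  map_smul' a c := by
    funext t
    simp only [filterApply, Pi.smul_apply, smul_eq_mul, mul_assoc, Finset.mul_sum,
      RingHom.id_apply]

lemma filterApplyₗ_apply (k : ℕ) (y : Signal) (c : Fin (m + 1) → ℂ) :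
    filterApplyₗ m k y c = filterApply k c y := rfl

/-- The filter with coefficients `exp(-2πi l j / (m + 1))`; these filters form the dual basis of the
Fourier transform, up to normalization. -/
noncomputable def modeFilter (m : ℕ) (l j : Fin (m + 1)) : ℂ :=
  mode m l (-((j : ℕ) : ℤ))

lemma inv_sqrt_mul_inv_sqrt :
    ((Real.sqrt (m + 1) : ℝ) : ℂ)⁻¹ * ((Real.sqrt (m + 1) : ℝ) : ℂ)⁻¹ = ((m : ℂ) + 1)⁻¹ := by
  rw [← mul_inv, ← Complex.ofReal_mul, Real.mul_self_sqrt (by positivity)]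
  push_cast
  rfl

lemma fourier_inversion (c : Fin (m + 1) → ℂ) :
    ((Real.sqrt (m + 1) : ℝ) : ℂ)⁻¹ •
      ∑ l : Fin (m + 1), dftU c l • modeFilter m l = c := by
  funext j
  have sum_modes (i : Fin (m + 1)) :
      ∑ l : Fin (m + 1), c i * mode m l (i : ℕ) * mode m l (-((j : ℕ) : ℤ)) =
        if i = j then c i * ((m : ℂ) + 1) else 0 := by
    have cast_eq : ((i : ℕ) : ℤ) + -((j : ℕ) : ℤ) = 0 ↔ i = j := by omega
    simp only [mul_assoc, ← mode_add, ← Finset.mul_sum]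
    rw [sum_mode (abs_le.2 (by omega)), mul_ite, mul_zero]
    simp only [cast_eq]
  simp only [Pi.smul_apply, Finset.sum_apply, smul_eq_mul, modeFilter, dftU_eq_sum_mode, mul_assoc,
    ← Finset.mul_sum]
  rw [← mul_assoc, inv_sqrt_mul_inv_sqrt]
  simp only [Finset.sum_mul]
  rw [Finset.sum_comm, Finset.sum_congr rfl fun i _ => sum_modes i, Finset.sum_ite_eq']
  have : (m : ℂ) + 1 ≠ 0 := Nat.cast_add_one_ne_zero m
  simp only [Finset.mem_univ, if_true]
  field_simp

lemma parseval {S : Finset ℤ} (hS : ∀ p ∈ S, ∀ q ∈ S, |p - q| ≤ m) (ψ : ℤ → ℂ) :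
    ∑ l : Fin (m + 1), ‖∑ p ∈ S, ψ p * mode m l p‖ ^ 2 = (m + 1) * ∑ p ∈ S, ‖ψ p‖ ^ 2 := by
  have orthogonality : ∀ p ∈ S, ∀ q ∈ S,
      ∑ l : Fin (m + 1), ψ p * mode m l p * (starRingEnd ℂ (ψ q) * mode m l (-q)) =
        if p = q then ψ p * starRingEnd ℂ (ψ q) * ((m : ℂ) + 1) else 0 := by
    intro p hp q hq
    have regroup (l : Fin (m + 1)) : ψ p * mode m l p * (starRingEnd ℂ (ψ q) * mode m l (-q)) =
        ψ p * starRingEnd ℂ (ψ q) * mode m l (p - q) := by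
      rw [mul_mul_mul_comm, ← mode_add, sub_eq_add_neg]
    rw [Finset.sum_congr rfl fun l _ => regroup l, ← Finset.mul_sum, sum_mode (hS p hp q hq),
      mul_ite, mul_zero]
    simp only [sub_eq_zero]
  have complex_parseval : ∑ l : Fin (m + 1),
      (∑ p ∈ S, ψ p * mode m l p) * starRingEnd ℂ (∑ p ∈ S, ψ p * mode m l p) =
        ((m : ℂ) + 1) * ∑ p ∈ S, ψ p * starRingEnd ℂ (ψ p) := by
    simp_rw [map_sum, map_mul, conj_mode, Finset.sum_mul_sum]
    rw [Finset.sum_comm, Finset.mul_sum]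
    refine Finset.sum_congr rfl fun p hp => ?_
    rw [Finset.sum_comm, Finset.sum_congr rfl (orthogonality p hp), Finset.sum_ite_eq, if_pos hp]
    ring
  simp_rw [Complex.mul_conj'] at complex_parseval
  exact_mod_cast complex_parseval

lemma LSProblem.Feasible.norm_le_of_norm_modeFilter_le {w : LSProblem} {c : Fin (w.m + 1) → ℂ}
    (hc : w.Feasible c) {E : Type*} [SeminormedAddCommGroup E] [NormedSpace ℂ E]
    (L : (Fin (w.m + 1) → ℂ) →ₗ[ℂ] E) {B : ℝ}
    (hB : ∀ l, ‖L (modeFilter w.m l)‖ ≤ B) :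
    ‖L c‖ ≤ w.rho / (w.m + 1) * B := by
  have hB0 : 0 ≤ B := (norm_nonneg _).trans (hB 0)
  have expansion : L c = ((Real.sqrt (w.m + 1) : ℝ) : ℂ)⁻¹ •
      ∑ l, dftU c l • L (modeFilter w.m l) := by
    conv_lhs => rw [← fourier_inversion c]
    simp only [map_smul, map_sum]
  have norm_sum : ‖∑ l, dftU c l • L (modeFilter w.m l)‖ ≤
      w.rho / Real.sqrt (w.m + 1) * B := by
    refine (norm_sum_le _ _).trans (le_trans ?_ (mul_le_mul_of_nonneg_right hc hB0))
    rw [Finset.sum_mul]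
    refine Finset.sum_le_sum fun l _ => ?_
    rw [norm_smul]
    exact mul_le_mul_of_nonneg_left (hB l) (norm_nonneg _)
  rw [expansion, norm_smul, norm_inv, Complex.norm_real, Real.norm_of_nonneg (Real.sqrt_nonneg _)]
  calc (Real.sqrt (w.m + 1))⁻¹ * _
      ≤ (Real.sqrt (w.m + 1))⁻¹ * (w.rho / Real.sqrt (w.m + 1) * B) := by gcongr
    _ = w.rho / (Real.sqrt (w.m + 1) * Real.sqrt (w.m + 1)) * B := by field_simp
    _ = w.rho / (w.m + 1) * B := by rw [Real.mul_self_sqrt (by positivity)]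

/-- The times at which the output at time `t` of a filter supported on `[-k, m - k]` reads its
input. -/
noncomputable def reach (m k : ℕ) (t : ℤ) : Finset ℤ :=
  Finset.Icc (t + k - m) (t + k)

lemma card_reach (k : ℕ) (t : ℤ) : (reach m k t).card = m + 1 := by
  rw [reach, Int.card_Icc]
  omega

lemma filterApply_modeFilter (k : ℕ) (l : Fin (m + 1)) (y : Signal) (t : ℤ) :
    filterApply k (modeFilter m l) y t =
      mode m l (-(t + k)) * ∑ r ∈ reach m k t, mode m l r * y r := by
  simp only [filterApply, modeFilter]
  rw [reach, Finset.mul_sum, Fin.sum_univ_eq_sum_range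
    (fun j => mode m l (-(j : ℤ)) * y (t - ((j : ℤ) - (k : ℤ)))) (m + 1)]
  refine Finset.sum_bij' (fun j _ => t + k - (j : ℤ)) (fun r _ => (t + k - r).toNat)
    (fun j hj => ?_) (fun r hr => ?_) (fun j _ => by simp) (fun r hr => ?_) (fun j _ => ?_)
  · rw [Finset.mem_range] at hj
    exact Finset.mem_Icc.2 (by omega)
  · rw [Finset.mem_Icc] at hr
    exact Finset.mem_range.2 (by omega)
  · rw [Finset.mem_Icc] at hr
    omega
  · rw [← mul_assoc, ← mode_add]
    congr 2 <;> ring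

namespace LSProblem.Feasible

variable {w : LSProblem} {c : Fin (w.m + 1) → ℂ} {y : Signal} {b : ℝ}

lemma norm_sq_filterApply_le (hc : w.Feasible c) {t : ℤ}
    (hb : ∀ l, ‖∑ r ∈ reach w.m w.k t, mode w.m l r * y r‖ ^ 2 ≤ b) :
    ‖filterApply w.k c y t‖ ^ 2 ≤ (w.rho / (w.m + 1)) ^ 2 * b := by
  have hb0 : 0 ≤ b := (sq_nonneg _).trans (hb 0)
  have norm_le : ‖filterApply w.k c y t‖ ≤ w.rho / (w.m + 1) * √b :=
    hc.norm_le_of_norm_modeFilter_le (LinearMap.proj t ∘ₗ filterApplyₗ w.m w.k y) fun l => by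
      simp only [LinearMap.comp_apply, LinearMap.proj_apply, filterApplyₗ_apply,
        filterApply_modeFilter, norm_mul, norm_mode, one_mul]
      exact Real.le_sqrt_of_sq_le (hb l)
  calc _ ≤ (w.rho / (w.m + 1) * √b) ^ 2 := by gcongr
    _ = _ := by rw [mul_pow, Real.sq_sqrt hb0]

lemma norm_inner_window_filterApply_le (hc : w.Feasible c) {F : Finset ℤ}
    (hb : ∀ l, ‖∑ t ∈ F, starRingEnd ℂ (mode w.m l t * y t) *
      ∑ r ∈ reach w.m w.k t, mode w.m l r * y r‖ ≤ b) :
    ‖inner ℂ (window F y) (window F (filterApply w.k c y))‖ ≤ w.rho / (w.m + 1) * b := by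
  refine hc.norm_le_of_norm_modeFilter_le
    (innerₛₗ ℂ (window F y) ∘ₗ window F ∘ₗ filterApplyₗ w.m w.k y) fun l => ?_
  have modulated : inner ℂ (window F y) (window F (filterApply w.k (modeFilter w.m l) y)) =
      mode w.m l (-w.k) * ∑ t ∈ F, starRingEnd ℂ (mode w.m l t * y t) *
        ∑ r ∈ reach w.m w.k t, mode w.m l r * y r := by
    rw [inner_window, Finset.mul_sum]
    refine Finset.sum_congr rfl fun t _ => ?_
    rw [filterApply_modeFilter, map_mul, conj_mode, neg_add, mode_add]
    ring
  simp only [LinearMap.comp_apply, innerₛₗ_apply_apply, filterApplyₗ_apply]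
  rw [modulated, norm_mul, norm_mode, one_mul]
  exact hb l

end LSProblem.Feasible

end Fourier

section AutoConvolution

/-- The coefficients of the filter `ψ * ψ`, where `ψ` is supported on `S`, indexed so that the
index `j` corresponds to the time `j - h`; it is the whole of `ψ * ψ` if `S + S ⊆ [-h, h]`. -/
noncomputable def autoConv (h : ℕ) (S : Finset ℤ) (ψ : ℤ → ℂ) (j : Fin (2 * h + 1)) : ℂ :=
  ∑ p ∈ S, ∑ q ∈ S, if p + q + h = ((j : ℕ) : ℤ) then ψ p * ψ q else 0

variable {h : ℕ} {S : Finset ℤ}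

lemma sum_autoConv_mul (hS : ∀ p ∈ S, ∀ q ∈ S, |p + q| ≤ h) (ψ G : ℤ → ℂ) :
    ∑ j : Fin (2 * h + 1), autoConv h S ψ j * G ((j : ℕ) : ℤ) =
      ∑ p ∈ S, ∑ q ∈ S, ψ p * ψ q * G (p + q + h) := by
  simp_rw [autoConv, Finset.sum_mul]
  rw [Finset.sum_comm]
  refine Finset.sum_congr rfl fun p hp => ?_
  rw [Finset.sum_comm]
  refine Finset.sum_congr rfl fun q hq => ?_
  have bounds := abs_le.1 (hS p hp q hq)
  lift p + q + h to ℕ using by omega with i hi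
  have hi_lt : i < 2 * h + 1 := by omega
  rw [Finset.sum_eq_single (⟨i, hi_lt⟩ : Fin (2 * h + 1)) (fun j _ hj => ?_) (by simp)]
  · simp
  · rw [if_neg (fun heq => hj (Fin.ext (by simpa using heq.symm))), zero_mul]

lemma filterApply_autoConv (hS : ∀ p ∈ S, ∀ q ∈ S, |p + q| ≤ h) (ψ : ℤ → ℂ) (x : Signal) (t : ℤ) :
    filterApply h (autoConv h S ψ) x t = ∑ p ∈ S, ψ p * ∑ q ∈ S, ψ q * x (t - p - q) := by
  rw [filterApply, sum_autoConv_mul hS ψ fun j => x (t - (j - h))]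
  simp_rw [Finset.mul_sum]
  refine Finset.sum_congr rfl fun p _ => Finset.sum_congr rfl fun q _ => ?_
  rw [mul_assoc]
  congr 3
  ring

lemma norm_dftU_autoConv (hS : ∀ p ∈ S, ∀ q ∈ S, |p + q| ≤ h) (ψ : ℤ → ℂ) (l : Fin (2 * h + 1)) :
    ‖dftU (autoConv h S ψ) l‖ =
      (Real.sqrt ((2 * h : ℕ) + 1))⁻¹ * ‖∑ p ∈ S, ψ p * mode (2 * h) l p‖ ^ 2 := by
  have factor : ∑ p ∈ S, ∑ q ∈ S, ψ p * ψ q * mode (2 * h) l (p + q + h) =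
      mode (2 * h) l h * (∑ p ∈ S, ψ p * mode (2 * h) l p) ^ 2 := by
    simp_rw [sq, Finset.sum_mul_sum, Finset.mul_sum, mode_add]
    exact Finset.sum_congr rfl fun p _ => Finset.sum_congr rfl fun q _ => by ring
  rw [dftU_eq_sum_mode, sum_autoConv_mul hS ψ (mode (2 * h) l), factor, norm_mul, norm_mul,
    norm_mode, one_mul, norm_pow, norm_inv, Complex.norm_real,
    Real.norm_of_nonneg (Real.sqrt_nonneg _)]

/-- Squaring `ψ` keeps the reproducing property, and turns the `ℓ₂` norm of its Fourier transform,
known by Parseval, into the `ℓ₁` norm of the constraint. -/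
lemma ShiftInvariant.exists_filter {V : Submodule ℂ Signal} [FiniteDimensional ℂ V]
    (hV : ShiftInvariant V) (h : ℕ) :
    ∃ c : Fin (2 * h + 1) → ℂ,
      ∑ l, ‖dftU c l‖ ≤ 4 * Module.finrank ℂ V / Real.sqrt ((2 * h : ℕ) + 1) ∧
      ∀ x ∈ V, ∀ t, filterApply h c x t = x t := by
  obtain ⟨S, ψ, hSub, hψ, hrep⟩ := hV.exists_reproducing (h / 2)
  have mem_bounds : ∀ p ∈ S, |p| ≤ h / 2 := fun p hp => abs_le.2 (Finset.mem_Icc.1 (hSub hp))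
  have hS : ∀ p ∈ S, ∀ q ∈ S, |p + q| ≤ h := fun p hp q hq =>
    (abs_add_le p q).trans (by have := mem_bounds p hp; have := mem_bounds q hq; omega)
  have hS' : ∀ p ∈ S, ∀ q ∈ S, |p - q| ≤ (2 * h : ℕ) := fun p hp q hq =>
    (abs_sub p q).trans (by have := mem_bounds p hp; have := mem_bounds q hq; omega)
  refine ⟨autoConv h S ψ, ?_, fun x hx t => ?_⟩
  · simp_rw [norm_dftU_autoConv hS]
    rw [← Finset.mul_sum, parseval hS', div_eq_inv_mul]
    refine mul_le_mul_of_nonneg_left ?_ (by positivity)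
    have half_le : ((2 * h : ℕ) : ℝ) + 1 ≤ 4 * (((h / 2 : ℕ) : ℝ) + 1) := by
      have : 2 * h + 1 ≤ 4 * (h / 2 + 1) := by omega
      exact_mod_cast this
    calc (((2 * h : ℕ) : ℝ) + 1) * ∑ p ∈ S, ‖ψ p‖ ^ 2
        ≤ 4 * (((h / 2 : ℕ) : ℝ) + 1) * (Module.finrank ℂ V / (((h / 2 : ℕ) : ℝ) + 1)) := by gcongr
      _ = 4 * Module.finrank ℂ V := by field_simp
  · rw [filterApply_autoConv hS]
    simp_rw [hrep x hx]

end AutoConvolution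

section UniformNoiseBounds

variable {Ω ι : Type*} [MeasurableSpace Ω] {P : Measure Ω} [IsProbabilityMeasure P]
  {ζ : ℤ → Ω → ℂ}

namespace IsStdComplexNoise

variable [Fintype ι] [Nonempty ι] {e : ι → ℤ → ℂ}

lemma exists_norm_sq_le_card (hζ : IsStdComplexNoise P ζ) (he : ∀ l r, ‖e l r‖ ≤ 1)
    (F : Finset ℤ) :
    ∃ Y : Ω → ℝ, MeanLE P Y (8 * (Real.log (Fintype.card ι) + 2)) ∧
      ∀ ω, 0 ≤ Y ω ∧ ∀ l, ‖∑ r ∈ F, e l r * ζ r ω‖ ^ 2 ≤ Y ω * F.card := by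
  obtain ⟨Y, hY, hle⟩ := hζ.exists_norm_sq_le F e
  refine ⟨Y, hY, fun ω => ⟨(hle ω).1, fun l => ((hle ω).2 l).trans ?_⟩⟩
  have sum_le : ∑ r ∈ F, ‖e l r‖ ^ 2 ≤ F.card := by
    simpa using Finset.sum_le_card_nsmul F _ 1 fun r _ => pow_le_one₀ (norm_nonneg _) (he l r)
  exact mul_le_mul_of_nonneg_left sum_le (hle ω).1

/-- The sums over `R t` are independent of the noise on `F`, so that conditionally on them the
left-hand side is the squared modulus of a Gaussian linear form. -/
lemma exists_norm_sq_cross_le (hζ : IsStdComplexNoise P ζ) (he : ∀ l r, ‖e l r‖ ≤ 1)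
    {F : Finset ℤ} {R : ℤ → Finset ℤ} (hR : ∀ t ∈ F, Disjoint (R t) F) :
    ∃ X : Ω → ℝ, MeanLE P X (8 * (Real.log (Fintype.card ι) + 2)) ∧ ∀ ω, 0 ≤ X ω ∧ ∀ l,
      ‖∑ t ∈ F, starRingEnd ℂ (∑ r ∈ R t, e l r * ζ r ω) * (e l t * ζ t ω)‖ ^ 2 ≤
        X ω * ∑ t ∈ F, ‖∑ r ∈ R t, e l r * ζ r ω‖ ^ 2 := by
  let a (l : ι) (z : Signal) (t : ℤ) : ℂ :=
    if t ∈ F then starRingEnd ℂ (∑ r ∈ R t, e l r * z r) * e l t else 0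
  have a_measurable (l r) : Measurable fun z => a l z r := by
    by_cases hr : r ∈ F
    · simp only [a, if_pos hr]
      exact (Complex.continuous_conj.measurable.comp (by fun_prop)).mul_const _
    · simp only [a, if_neg hr, measurable_const]
  have a_dependsOn (l) : DependsOn (a l) (F.biUnion R : Finset ℤ) := by
    intro z z' hz
    funext t
    refine if_ctx_congr Iff.rfl (fun ht => ?_) fun _ => rfl
    rw [Finset.sum_congr rfl fun r hr => by rw [hz r (Finset.mem_biUnion.2 ⟨t, ht, hr⟩)]]
  obtain ⟨X, hX, X_le⟩ := hζ.exists_norm_sq_le_of_disjoint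
    ((Finset.disjoint_biUnion_left _ _ _).2 hR) a_measurable a_dependsOn
  refine ⟨X, hX, fun ω => ⟨(X_le ω).1, fun l => ?_⟩⟩
  have linear_form : ∑ t ∈ F, starRingEnd ℂ (∑ r ∈ R t, e l r * ζ r ω) * (e l t * ζ t ω) =
      ∑ t ∈ F, a l (fun i => ζ i ω) t * ζ t ω :=
    Finset.sum_congr rfl fun t ht => by simp only [a, if_pos ht, mul_assoc]
  rw [linear_form]
  refine ((X_le ω).2 l).trans (mul_le_mul_of_nonneg_left ?_ (X_le ω).1)
  refine Finset.sum_le_sum fun t ht => ?_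
  simp only [a, if_pos ht]
  rw [norm_mul, RCLike.norm_conj, mul_pow]
  exact mul_le_of_le_one_right (sq_nonneg _) (pow_le_one₀ (norm_nonneg _) (he l t))

lemma exists_cross_bound (hζ : IsStdComplexNoise P ζ) (he : ∀ l r, ‖e l r‖ ≤ 1) {F : Finset ℤ}
    {R : ℤ → Finset ℤ} (hR : ∀ t ∈ F, Disjoint (R t) F) {M : ℕ} (hF : F.card ≤ M)
    (hRM : ∀ t ∈ F, (R t).card ≤ M) :
    ∃ Y : Ω → ℝ, MeanLE P Y (8 * M * (Real.log (Fintype.card ι) + 2)) ∧ ∀ ω l,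
      ‖∑ t ∈ F, starRingEnd ℂ (∑ r ∈ R t, e l r * ζ r ω) * (e l t * ζ t ω)‖ ≤ Y ω := by
  obtain ⟨X, hX, X_le⟩ := hζ.exists_norm_sq_cross_le he hR
  choose Y hY Y_le using fun t => hζ.exists_norm_sq_le_card he (R t)
  refine ⟨fun ω => (1 / 2) * (M * X ω + ∑ t ∈ F, Y t ω), ?_, fun ω l => ?_⟩
  · have log_nonneg : 0 ≤ Real.log (Fintype.card ι) := Real.log_natCast_nonneg _
    have hF' : (F.card : ℝ) ≤ M := by exact_mod_cast hF
    refine (((hX.const_mul M.cast_nonneg).add (MeanLE.sum F (fun t _ => hY t) fun _ _ => ?_)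
      ?_ ?_).const_mul (by norm_num)).mono ?_
    any_goals positivity
    rw [Finset.sum_const, nsmul_eq_mul]
    nlinarith
  · have X_nonneg := (X_le ω).1
    have Y_sum_nonneg : 0 ≤ ∑ t ∈ F, Y t ω := Finset.sum_nonneg fun t _ => (Y_le t ω).1
    have sum_le : ∑ t ∈ F, ‖∑ r ∈ R t, e l r * ζ r ω‖ ^ 2 ≤ M * ∑ t ∈ F, Y t ω := by
      rw [Finset.mul_sum]
      refine Finset.sum_le_sum fun t ht => ((Y_le t ω).2 l).trans ?_
      rw [mul_comm]
      exact mul_le_mul_of_nonneg_right (by exact_mod_cast hRM t ht) (Y_le t ω).1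
    have norm_sq_le := ((X_le ω).2 l).trans (mul_le_mul_of_nonneg_left sum_le X_nonneg)
    refine abs_le_of_sq_le_sq' ?_ (by positivity) |>.2
    nlinarith [sq_nonneg (M * X ω - ∑ t ∈ F, Y t ω)]

lemma exists_quadratic_bound (hζ : IsStdComplexNoise P ζ) (he : ∀ l r, ‖e l r‖ ≤ 1)
    {F : Finset ℤ} {R : ℤ → Finset ℤ} (hFR : ∀ t ∈ F, F ⊆ R t) {M : ℕ}
    (hRM : ∀ t ∈ F, (R t).card ≤ M) :
    ∃ Y : Ω → ℝ, MeanLE P Y (16 * M * (Real.log (Fintype.card ι) + 2)) ∧ ∀ ω l,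
      ‖∑ t ∈ F, starRingEnd ℂ (e l t * ζ t ω) * ∑ r ∈ R t, e l r * ζ r ω‖ ≤ Y ω := by
  have hF : F.card ≤ M := by
    rcases F.eq_empty_or_nonempty with rfl | ⟨t, ht⟩
    · simp
    · exact (Finset.card_le_card (hFR t ht)).trans (hRM t ht)
  obtain ⟨Y, hY, Y_le⟩ := hζ.exists_norm_sq_le_card he F
  obtain ⟨X, hX, X_le⟩ := hζ.exists_cross_bound he (R := fun t => R t \ F)
    (fun t _ => Finset.sdiff_disjoint) hF fun t ht =>
      (Finset.card_le_card Finset.sdiff_subset).trans (hRM t ht)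
  refine ⟨fun ω => M * Y ω + X ω,
    ((hY.const_mul M.cast_nonneg).add hX (by positivity) (by positivity)).mono (by linarith),
    fun ω l => ?_⟩
  have split : ∑ t ∈ F, starRingEnd ℂ (e l t * ζ t ω) * ∑ r ∈ R t, e l r * ζ r ω =
      starRingEnd ℂ (∑ t ∈ F, e l t * ζ t ω) * ∑ t ∈ F, e l t * ζ t ω + starRingEnd ℂ
        (∑ t ∈ F, starRingEnd ℂ (∑ r ∈ R t \ F, e l r * ζ r ω) * (e l t * ζ t ω)) := by
    simp only [map_sum (starRingEnd ℂ), map_mul, Complex.conj_conj]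
    rw [Finset.sum_mul, ← Finset.sum_add_distrib]
    refine Finset.sum_congr rfl fun t ht => ?_
    rw [← Finset.sum_sdiff (hFR t ht)]
    ring
  rw [split]
  refine (norm_add_le _ _).trans (add_le_add ?_ ?_)
  · rw [norm_mul, RCLike.norm_conj, ← sq, mul_comm]
    refine ((Y_le ω).2 l).trans (mul_le_mul_of_nonneg_left ?_ (Y_le ω).1)
    exact_mod_cast hF
  · rw [RCLike.norm_conj]
    exact X_le ω l

lemma exists_energy_bound (hζ : IsStdComplexNoise P ζ) (w : LSProblem) (F : Finset ℤ) :
    ∃ A : Ω → ℝ,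
      MeanLE P A (8 * w.rho ^ 2 * (F.card / (w.m + 1)) * (Real.log (w.m + 1) + 2)) ∧
      ∀ ω c, w.Feasible c → ‖window F (filterApply w.k c fun t => ζ t ω)‖ ^ 2 ≤ A ω := by
  choose Y hY Y_le using fun t => hζ.exists_norm_sq_le_card (e := mode w.m)
    (fun l r => (norm_mode l r).le) (reach w.m w.k t)
  simp only [card_reach, Fintype.card_fin, Nat.cast_add_one] at hY Y_le
  have log_nonneg : 0 ≤ Real.log (w.m + 1) := by exact_mod_cast Real.log_natCast_nonneg (w.m + 1)
  refine ⟨fun ω => w.rho ^ 2 / (w.m + 1) * ∑ t ∈ F, Y t ω,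
    ((MeanLE.sum F (fun t _ => hY t) fun _ _ => by positivity).const_mul (by positivity)).mono ?_,
    fun ω c hc => ?_⟩
  · rw [Finset.sum_const, nsmul_eq_mul]
    exact le_of_eq (by ring)
  · simp only [norm_sq_window, Finset.mul_sum]
    refine Finset.sum_le_sum fun t _ => ?_
    refine (hc.norm_sq_filterApply_le (Y_le t ω).2).trans_eq ?_
    field_simp

lemma exists_correlation_bound (hζ : IsStdComplexNoise P ζ) {w : LSProblem} (hrho : 0 ≤ w.rho)
    {F : Finset ℤ} (hF : ∀ t ∈ F, F ⊆ reach w.m w.k t) :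
    ∃ G : Ω → ℝ, MeanLE P G (16 * w.rho * (Real.log (w.m + 1) + 2)) ∧
      ∀ ω c, w.Feasible c → ‖inner ℂ (window F fun t => ζ t ω)
        (window F (filterApply w.k c fun t => ζ t ω))‖ ≤ G ω := by
  obtain ⟨Y, hY, Y_le⟩ := hζ.exists_quadratic_bound (e := mode w.m)
    (fun l r => (norm_mode l r).le) hF fun t _ => (card_reach w.k t).le
  simp only [Fintype.card_fin, Nat.cast_add_one] at hY
  refine ⟨fun ω => w.rho / (w.m + 1) * Y ω, (hY.const_mul (by positivity)).mono ?_,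
    fun ω c hc => ?_⟩
  · refine le_of_eq ?_
    field_simp
  · exact hc.norm_inner_window_filterApply_le (Y_le ω)

end IsStdComplexNoise

end UniformNoiseBounds

section OracleInequality

lemma norm_sq_sub_smul_le {𝕜 E : Type*} [RCLike 𝕜] [SeminormedAddCommGroup E]
    [InnerProductSpace 𝕜 E] {z v f f₀ : E} {σ A G B : ℝ}
    (hmin : ‖(v - (σ : 𝕜) • f) + (σ : 𝕜) • z‖ ≤ ‖(σ : 𝕜) • (z - f₀)‖)
    (hf : ‖f‖ ^ 2 ≤ A) (hf₀ : ‖f₀‖ ^ 2 ≤ A) (hzf : ‖inner 𝕜 z f‖ ≤ G) (hzf₀ : ‖inner 𝕜 z f₀‖ ≤ G)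
    (hzv : ‖inner 𝕜 z v‖ ^ 2 ≤ B * ‖v‖ ^ 2) (hB : 0 ≤ B) :
    ‖v - (σ : 𝕜) • f‖ ^ 2 ≤ σ ^ 2 * (3 * A + 8 * G + 8 * B) := by
  obtain ⟨e, he⟩ : ∃ e, e = v - (σ : 𝕜) • f := ⟨_, rfl⟩
  rw [← he] at hmin ⊢
  have expand_min : ‖e‖ ^ 2 + 2 * (σ * RCLike.re (inner 𝕜 z e)) ≤
      σ ^ 2 * (‖f₀‖ ^ 2 - 2 * RCLike.re (inner 𝕜 z f₀)) := by
    have sq_min := pow_le_pow_left₀ (norm_nonneg _) hmin 2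
    rw [add_comm e, norm_smul, mul_pow, RCLike.norm_ofReal, sq_abs, @norm_add_sq 𝕜,
      @norm_sub_sq 𝕜, inner_smul_left, norm_smul, mul_pow, RCLike.norm_ofReal, sq_abs,
      RCLike.conj_ofReal, RCLike.re_ofReal_mul] at sq_min
    linarith
  have split_inner : RCLike.re (inner 𝕜 z e) =
      RCLike.re (inner 𝕜 z v) - σ * RCLike.re (inner 𝕜 z f) := by
    rw [he, inner_sub_right, inner_smul_right, map_sub, RCLike.re_ofReal_mul]
  have v_norm_sq_le : ‖v‖ ^ 2 ≤ 2 * ‖e‖ ^ 2 + 2 * (σ ^ 2 * A) := by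
    have v_norm_le : ‖v‖ ≤ ‖e‖ + |σ| * ‖f‖ := by
      simpa [he, norm_smul] using norm_add_le e ((σ : 𝕜) • f)
    nlinarith [norm_nonneg v, sq_nonneg (‖e‖ - |σ| * ‖f‖), sq_abs σ,
      mul_le_mul_of_nonneg_left hf (sq_nonneg σ)]
  have projection_term : |2 * σ * RCLike.re (inner 𝕜 z v)| ≤ 4 * σ ^ 2 * B + ‖v‖ ^ 2 / 4 := by
    refine abs_le_of_sq_le_sq ?_ (by positivity)
    have re_sq_le : RCLike.re (inner 𝕜 z v) ^ 2 ≤ B * ‖v‖ ^ 2 :=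
      (sq_le_sq' (abs_le.1 (RCLike.abs_re_le_norm _)).1 (RCLike.re_le_norm _)).trans hzv
    nlinarith [sq_nonneg (4 * σ ^ 2 * B - ‖v‖ ^ 2 / 4),
      mul_le_mul_of_nonneg_left re_sq_le (sq_nonneg σ)]
  have filter_terms : σ ^ 2 * (‖f₀‖ ^ 2 - 2 * RCLike.re (inner 𝕜 z f₀) +
      2 * RCLike.re (inner 𝕜 z f)) ≤ σ ^ 2 * (A + 4 * G) := by
    have re_f_le := (RCLike.re_le_norm _).trans hzf
    have re_f₀_ge := (abs_le.1 ((RCLike.abs_re_le_norm _).trans hzf₀)).1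
    exact mul_le_mul_of_nonneg_left (by linarith) (sq_nonneg σ)
  rw [split_inner] at expand_min
  linarith [neg_le_of_abs_le projection_term]

variable {m : ℕ} {V : Submodule ℂ Signal} {w : LSProblem} {x z : Signal} {σ : ℝ}

lemma observe_eq (x : Signal) (σ : ℝ) (z : Signal) : observe x σ z = x + (σ : ℂ) • z := rfl

lemma filterApply_observe (k : ℕ) (c : Fin (m + 1) → ℂ) (x : Signal) (σ : ℝ) (z : Signal) :
    filterApply k c (observe x σ z) = filterApply k c x + (σ : ℂ) • filterApply k c z := by
  funext t
  simp only [filterApply, observe, Pi.add_apply, Pi.smul_apply, smul_eq_mul, mul_add,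
    Finset.sum_add_distrib, Finset.mul_sum, mul_left_comm (σ : ℂ)]

lemma ShiftInvariant.filterApply_mem (hV : ShiftInvariant V) (k : ℕ) (c : Fin (m + 1) → ℂ)
    (hx : x ∈ V) : filterApply k c x ∈ V := by
  have sum_shifts : filterApply k c x =
      ∑ j : Fin (m + 1), c j • fun t => x (t + -(((j : ℕ) : ℤ) - (k : ℤ))) := by
    ext t
    simp [filterApply, sub_eq_add_neg]
  rw [sum_shifts]
  exact Submodule.sum_mem _ fun j _ => Submodule.smul_mem _ _ (hV x hx _)

lemma LSProblem.residual_eq_norm_sq (w : LSProblem) (y : Signal) (c : Fin (w.m + 1) → ℂ) :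
    w.residual y c = ‖window (Finset.Icc w.left w.right) (y - filterApply w.k c y)‖ ^ 2 := by
  rw [norm_sq_window]
  rfl

lemma LSProblem.IsSolution.oracle_inequality {c c₀ : Fin (w.m + 1) → ℂ} {A G B : ℝ}
    (hc : w.IsSolution (observe x σ z) c) (hV : ShiftInvariant V) (hx : x ∈ V)
    (hc₀ : w.Feasible c₀) (hrep : filterApply w.k c₀ x = x)
    (hA : ∀ c', w.Feasible c' →
      ‖window (Finset.Icc w.left w.right) (filterApply w.k c' z)‖ ^ 2 ≤ A)
    (hG : ∀ c', w.Feasible c' → ‖inner ℂ (window (Finset.Icc w.left w.right) z)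
      (window (Finset.Icc w.left w.right) (filterApply w.k c' z))‖ ≤ G)
    (hB : ∀ v ∈ V, ‖inner ℂ (window (Finset.Icc w.left w.right) z)
      (window (Finset.Icc w.left w.right) v)‖ ^ 2 ≤
        B * ‖window (Finset.Icc w.left w.right) v‖ ^ 2) (hB0 : 0 ≤ B) :
    ‖window (Finset.Icc w.left w.right) (x - filterApply w.k c (observe x σ z))‖ ^ 2 ≤
      σ ^ 2 * (3 * A + 8 * G + 8 * B) := by
  have hmin := hc.2 c₀ hc₀
  rw [LSProblem.residual_eq_norm_sq, LSProblem.residual_eq_norm_sq,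
    sq_le_sq₀ (norm_nonneg _) (norm_nonneg _)] at hmin
  have oracle_residual : observe x σ z - filterApply w.k c₀ (observe x σ z) =
      (σ : ℂ) • (z - filterApply w.k c₀ z) := by
    rw [filterApply_observe, hrep, observe_eq]
    module
  have solution_residual : observe x σ z - filterApply w.k c (observe x σ z) =
      ((x - filterApply w.k c x) - (σ : ℂ) • filterApply w.k c z) + (σ : ℂ) • z := by
    rw [filterApply_observe, observe_eq]
    module
  have error_eq : x - filterApply w.k c (observe x σ z) =
      (x - filterApply w.k c x) - (σ : ℂ) • filterApply w.k c z := by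
    rw [filterApply_observe]
    module
  rw [oracle_residual, solution_residual] at hmin
  rw [error_eq]
  have hv : x - filterApply w.k c x ∈ V := V.sub_mem hx (hV.filterApply_mem _ _ hx)
  generalize x - filterApply w.k c x = v at hv hmin ⊢
  simp only [map_sub, map_add, map_smul] at hmin ⊢
  exact norm_sq_sub_smul_le hmin (hA c hc.1) (hA c₀ hc₀) (hG c hc.1) (hG c₀ hc₀)
    (hB v hv) hB0

end OracleInequality

section MeasurableArgmin

open Filter Topology

variable {X Y ι : Type*} [TopologicalSpace X] {K : Set X}

lemma continuous_of_unique_isMinOn [TopologicalSpace Y] (hK : IsCompact K)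
    {f : Y → X → ℝ} (hf : Continuous (Function.uncurry f)) {g : Y → X} (hg : ∀ y, g y ∈ K)
    (hmin : ∀ y, IsMinOn (f y) K (g y))
    (hunique : ∀ y, ∀ c ∈ K, IsMinOn (f y) K c → c = g y) : Continuous g := by
  refine continuous_iff_continuousAt.2 fun y =>
    hK.tendsto_nhds_of_unique_mapClusterPt (Eventually.of_forall hg) fun c hc hcluster =>
      hunique y c hc fun c' hc' => ?_
  obtain ⟨U, hUy, hUc⟩ := mapClusterPt_iff_ultrafilter.1 hcluster
  have values_tendsto : Tendsto (fun z => f z (g z)) U (𝓝 (f y c)) :=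
    (hf.tendsto (y, c)).comp (Tendsto.prodMk_nhds hUy hUc)
  have competitor_tendsto : Tendsto (fun z => f z c') U (𝓝 (f y c')) :=
    (hf.tendsto (y, c')).comp (Tendsto.prodMk_nhds hUy tendsto_const_nhds)
  exact le_of_tendsto_of_tendsto' values_tendsto competitor_tendsto fun z => hmin z hc'

lemma tendsto_of_isMinOn_mul_add (hK : IsCompact K) {f q : X → ℝ} (hf : Continuous f)
    (hq : Continuous q) {l : Filter ι} {r : ι → ℝ} (hr : Tendsto r l atTop) {g : ι → X}
    (hg : ∀ i, g i ∈ K) (hgmin : ∀ i, IsMinOn (fun x => r i * f x + q x) K (g i)) {c : X}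
    (hc : c ∈ K) (hcmin : IsMinOn f K c)
    (hunique : ∀ d ∈ K, IsMinOn f K d → q d ≤ q c → d = c) : Tendsto g l (𝓝 c) := by
  refine hK.tendsto_nhds_of_unique_mapClusterPt (Eventually.of_forall hg) fun d hd hcluster => ?_
  obtain ⟨U, hUl, hUd⟩ := mapClusterPt_iff_ultrafilter.1 hcluster
  have f_tendsto := (hf.tendsto d).comp hUd
  have q_tendsto := (hq.tendsto d).comp hUd
  have r_pos : ∀ᶠ i in U, 0 < r i := (hr.eventually_gt_atTop 0).filter_mono hUl
  refine hunique d hd (fun c' hc' => ?_) (le_of_tendsto q_tendsto ?_)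
  · have bound_tendsto : Tendsto (fun i => f c' + (r i)⁻¹ * (q c' - q (g i))) U
        (𝓝 (f c' + 0 * (q c' - q d))) :=
      ((hr.mono_left hUl).inv_tendsto_atTop.mul (q_tendsto.const_sub _)).const_add _
    rw [zero_mul, add_zero] at bound_tendsto
    refine le_of_tendsto_of_tendsto f_tendsto bound_tendsto (r_pos.mono fun i hi => ?_)
    have optimal : r i * f (g i) + q (g i) ≤ r i * f c' + q c' := hgmin i hc'
    rw [Function.comp_apply, ← sub_le_iff_le_add', inv_mul_eq_div, le_div_iff₀ hi]
    linarith
  · refine r_pos.mono fun i hi => ?_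
    have optimal : r i * f (g i) + q (g i) ≤ r i * f c + q c := hgmin i hc
    exact le_of_add_le_add_left
      (optimal.trans (by gcongr; exact hcmin (hg i)) : r i * f (g i) + q (g i) ≤ _)

variable {E : Type*} [NormedAddCommGroup E] [NormedSpace ℝ E] {K : Set E} {q : E → ℝ}

lemma exists_isMinOn_of_strictConvexOn (hK : IsCompact K) (hne : K.Nonempty)
    {f : E → ℝ} (hf : Continuous f) (hconv : ConvexOn ℝ K f) (hq : Continuous q)
    (hqconv : StrictConvexOn ℝ K q) :
    ∃ c ∈ K, IsMinOn f K c ∧ ∀ d ∈ K, IsMinOn f K d → q d ≤ q c → d = c := by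
  obtain ⟨c₀, hc₀, hc₀min⟩ := hK.exists_isMinOn hne hf.continuousOn
  have argmin_compact : IsCompact {c ∈ K | f c ≤ f c₀} :=
    hK.inter_right (isClosed_le hf continuous_const)
  obtain ⟨c, hc, hcmin⟩ := argmin_compact.exists_isMinOn ⟨c₀, hc₀, le_rfl⟩ hq.continuousOn
  refine ⟨c, hc.1, fun d hd => hc.2.trans (hc₀min hd), fun d hd hdmin hqd => ?_⟩
  exact (hqconv.subset (fun _ h => h.1) (hconv.convex_le _)).eq_of_isMinOn
    (fun e he => hqd.trans (hcmin he)) hcmin ⟨hd, hdmin hc₀⟩ hc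

/-- The minimizer of `f y` with the least value of `q` is the limit of the unique minimizers of
`n * f y + q`, which are continuous in `y`. -/
lemma exists_measurable_isMinOn [TopologicalSpace Y] [MeasurableSpace Y]
    [OpensMeasurableSpace Y] [MeasurableSpace E] [BorelSpace E] (hK : IsCompact K)
    (hne : K.Nonempty) {f : Y → E → ℝ} (hf : Continuous (Function.uncurry f))
    (hconv : ∀ y, ConvexOn ℝ K (f y)) (hq : Continuous q) (hqconv : StrictConvexOn ℝ K q) :
    ∃ g : Y → E, Measurable g ∧ ∀ y, g y ∈ K ∧ IsMinOn (f y) K (g y) := by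
  have hfy : ∀ y, Continuous (f y) := fun y => hf.comp (Continuous.prodMk_right y)
  have objective_continuous (n : ℕ) :
      Continuous (Function.uncurry fun y x => (n : ℝ) * f y x + q x) :=
    (continuous_const.mul hf).add (hq.comp continuous_snd)
  have objective_convex (n : ℕ) (y : Y) : StrictConvexOn ℝ K fun x => (n : ℝ) * f y x + q x :=
    ((hconv y).smul n.cast_nonneg).add_strictConvexOn hqconv
  choose G hGK hGmin using fun (n : ℕ) (y : Y) => hK.exists_isMinOn hne
    ((objective_continuous n).comp (Continuous.prodMk_right y)).continuousOn
  have hGcont (n : ℕ) : Continuous (G n) :=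
    continuous_of_unique_isMinOn hK (objective_continuous n) (hGK n) (hGmin n) fun y c hc hcmin =>
      (objective_convex n y).eq_of_isMinOn hcmin (hGmin n y) hc (hGK n y)
  choose g hgK hgmin hgunique using fun y =>
    exists_isMinOn_of_strictConvexOn hK hne (hfy y) (hconv y) hq hqconv
  have G_tendsto (y : Y) : Tendsto (fun n => G n y) atTop (𝓝 (g y)) :=
    tendsto_of_isMinOn_mul_add hK (hfy y) hq tendsto_natCast_atTop_atTop (fun n => hGK n y)
      (fun n => hGmin n y) (hgK y) (hgmin y) (hgunique y)
  exact ⟨g, measurable_of_tendsto_metrizable (fun n => (hGcont n).measurable)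
    (tendsto_pi_nhds.2 G_tendsto), fun y => ⟨hgK y, hgmin y⟩⟩

lemma strictConvexOn_sum_norm_sq [Fintype ι] {F : Type*} [NormedAddCommGroup F]
    [InnerProductSpace ℝ F] : StrictConvexOn ℝ Set.univ fun c : ι → F => ∑ i, ‖c i‖ ^ 2 := by
  have norm_sq_strict : StrictConvexOn ℝ Set.univ fun v : PiLp 2 fun _ : ι => F => ‖v‖ ^ 2 :=
    StrongConvexOn.strictConvexOn (m := 2)
      (strongConvexOn_iff_convex.2 (by simpa using convexOn_const 0 convex_univ)) two_pos
  refine ⟨convex_univ, fun c _ c' _ hne a b ha hb hab => ?_⟩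
  simpa [PiLp.norm_sq_eq_of_L2] using norm_sq_strict.2 (Set.mem_univ (WithLp.toLp 2 c))
    (Set.mem_univ (WithLp.toLp 2 c')) (by simpa using hne) ha hb hab

end MeasurableArgmin

section MeasurableSolution

lemma continuous_filterApply {m : ℕ} (k : ℕ) (t : ℤ) :
    Continuous fun p : Signal × (Fin (m + 1) → ℂ) => filterApply k p.2 p.1 t := by
  unfold filterApply
  fun_prop

/-- The sequence cut down to `[-N, N]` and extended by zero. It turns an optimal solution into a
function of the observations on `[-N, N]` only. -/
noncomputable def truncate (N : ℕ) (y : Signal) : Signal :=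
  fun t => if t ∈ Set.Icc (-(N : ℤ)) N then y t else 0

lemma truncate_truncate (N : ℕ) (y : Signal) : truncate N (truncate N y) = truncate N y := by
  funext t
  simp only [truncate]
  split_ifs <;> rfl

lemma truncate_congr {N : ℕ} {y y' : Signal} (h : ∀ t ∈ Set.Icc (-(N : ℤ)) N, y t = y' t) :
    truncate N y = truncate N y' := by
  funext t
  exact ite_congr rfl (h t) fun _ => rfl

lemma measurable_truncate (N : ℕ) : Measurable (truncate N) := by
  refine measurable_pi_lambda _ fun t => ?_
  unfold truncate
  split_ifs <;> fun_prop

namespace LSProblem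

variable {w : LSProblem} {N : ℕ}

lemma isCompact_feasible (w : LSProblem) : IsCompact {c | w.Feasible c} := by
  refine Metric.isCompact_of_isClosed_isBounded ?_ (isBounded_iff_forall_norm_le.2
    ⟨w.rho / (w.m + 1) * 1, fun c hc => hc.norm_le_of_norm_modeFilter_le LinearMap.id fun l => ?_⟩)
  · refine isClosed_le ?_ continuous_const
    unfold dftU
    fun_prop
  · exact (pi_norm_le_iff_of_nonneg zero_le_one).2 fun j => (norm_mode ..).le

lemma convex_feasible (w : LSProblem) : Convex ℝ {c | w.Feasible c} := by
  intro c hc c' hc' a b ha hb hab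
  have dft_combination : dftU (a • c + b • c') = a • dftU c + b • dftU c' := by
    let L := (dftUₗ w.m).restrictScalars ℝ
    exact (L.map_add _ _).trans (congrArg₂ _ (L.map_smul a c) (L.map_smul b c'))
  calc ∑ l, ‖dftU (a • c + b • c') l‖ ≤ ∑ l, (a * ‖dftU c l‖ + b * ‖dftU c' l‖) := by
        refine Finset.sum_le_sum fun l _ => ?_
        rw [dft_combination]
        refine (norm_add_le _ _).trans_eq ?_
        rw [Pi.smul_apply, Pi.smul_apply, norm_smul_of_nonneg ha, norm_smul_of_nonneg hb]
    _ = a * ∑ l, ‖dftU c l‖ + b * ∑ l, ‖dftU c' l‖ := by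
        rw [Finset.sum_add_distrib, Finset.mul_sum, Finset.mul_sum]
    _ ≤ a * (w.rho / Real.sqrt (w.m + 1)) + b * (w.rho / Real.sqrt (w.m + 1)) :=
        add_le_add (mul_le_mul_of_nonneg_left hc ha) (mul_le_mul_of_nonneg_left hc' hb)
    _ = w.rho / Real.sqrt (w.m + 1) := by rw [← add_mul, hab, one_mul]

lemma feasible_zero (hw : 0 ≤ w.rho) : w.Feasible 0 := by
  have : ∑ l, ‖dftUₗ w.m 0 l‖ ≤ w.rho / Real.sqrt (w.m + 1) := by
    simp only [map_zero, Pi.zero_apply, norm_zero, Finset.sum_const_zero]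
    positivity
  exact this

lemma convexOn_residual (w : LSProblem) (y : Signal) : ConvexOn ℝ Set.univ (w.residual y) := by
  let F := Finset.Icc w.left w.right
  let misfit : (Fin (w.m + 1) → ℂ) →ᵃ[ℝ] EuclideanSpace ℂ F :=
    AffineMap.const ℝ _ (window F y) -
      ((window F ∘ₗ filterApplyₗ w.m w.k y).restrictScalars ℝ).toAffineMap
  have residual_eq : w.residual y = (fun v => ‖v‖ ^ 2) ∘ misfit := by
    funext c
    rw [residual_eq_norm_sq, map_sub]
    rfl
  rw [residual_eq]
  exact ((convexOn_norm convex_univ).pow (fun _ _ => norm_nonneg _) 2).comp_affineMap misfit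

lemma continuous_residual (w : LSProblem) : Continuous (Function.uncurry w.residual) := by
  have filter_continuous := fun t => continuous_filterApply (m := w.m) w.k t
  unfold residual Function.uncurry
  fun_prop

lemma Admissible.filterApply_truncate (hw : w.Admissible N) (y : Signal)
    (c : Fin (w.m + 1) → ℂ) {t : ℤ} (ht : t ∈ Set.Icc w.left w.right) :
    filterApply w.k c (truncate N y) t = filterApply w.k c y t := by
  obtain ⟨-, k_le, -, left_ge, right_le⟩ := hw
  refine Finset.sum_congr rfl fun j _ => ?_
  have := j.2
  rw [Set.mem_Icc] at ht
  rw [truncate, if_pos (by rw [Set.mem_Icc]; omega)]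

lemma Admissible.residual_truncate (hw : w.Admissible N) (y : Signal)
    (c : Fin (w.m + 1) → ℂ) : w.residual (truncate N y) c = w.residual y c := by
  refine Finset.sum_congr rfl fun t ht => ?_
  rw [Finset.mem_Icc] at ht
  rw [hw.filterApply_truncate y c ht]
  obtain ⟨-, k_le, -, left_ge, right_le⟩ := hw
  rw [truncate, if_pos (by rw [Set.mem_Icc]; omega)]

lemma Admissible.exists_measurable_solution (hw : w.Admissible N) :
    ∃ φ : Signal → Fin (w.m + 1) → ℂ, Measurable φ ∧ (∀ y, w.IsSolution y (φ y)) ∧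
      ∀ y, φ (truncate N y) = φ y := by
  obtain ⟨g, hg, hmin⟩ := exists_measurable_isMinOn w.isCompact_feasible
    ⟨0, feasible_zero (zero_le_one.trans hw.2.2.1)⟩ w.continuous_residual
    (fun y => (w.convexOn_residual y).subset (Set.subset_univ _) w.convex_feasible)
    (q := fun c => ∑ j, ‖c j‖ ^ 2) (by fun_prop)
    (strictConvexOn_sum_norm_sq.subset (Set.subset_univ _) w.convex_feasible)
  refine ⟨fun y => g (truncate N y), hg.comp (measurable_truncate N),
    fun y => ⟨(hmin _).1, fun c' hc' => ?_⟩, fun y => congrArg g (truncate_truncate N y)⟩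
  have optimal : w.residual (truncate N y) (g (truncate N y)) ≤ w.residual (truncate N y) c' :=
    (hmin (truncate N y)).2 hc'
  rwa [hw.residual_truncate, hw.residual_truncate] at optimal

end LSProblem

end MeasurableSolution

section WindowError

variable {V : Submodule ℂ Signal} [FiniteDimensional ℂ V] {w : LSProblem}

lemma ShiftInvariant.exists_feasible_filter (hV : ShiftInvariant V) (hm : w.m = 2 * w.k)
    (hrho : 4 * Module.finrank ℂ V ≤ w.rho) :
    ∃ c, w.Feasible c ∧ ∀ x ∈ V, filterApply w.k c x = x := by
  obtain ⟨left, right, m, k, rho⟩ := w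
  obtain rfl : m = 2 * k := hm
  obtain ⟨c, hc, hrep⟩ := hV.exists_filter k
  exact ⟨c, hc.trans (by gcongr), fun x hx => funext (hrep x hx)⟩

lemma LSProblem.subset_reach (hm : w.m = 2 * w.k) (hlen : w.right - w.left ≤ w.k) {t : ℤ}
    (ht : t ∈ Finset.Icc w.left w.right) :
    Finset.Icc w.left w.right ⊆ reach w.m w.k t := by
  rw [Finset.mem_Icc] at ht
  exact Finset.Icc_subset_Icc (by omega) (by omega)

lemma IsStdComplexNoise.exists_window_error_bound {Ω : Type*} [MeasurableSpace Ω]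
    {P : Measure Ω} [IsProbabilityMeasure P] {ζ : ℤ → Ω → ℂ} (hζ : IsStdComplexNoise P ζ)
    (hV : ShiftInvariant V) (hm : w.m = 2 * w.k) (hlen : w.right - w.left ≤ w.k)
    (hrho : 4 * Module.finrank ℂ V ≤ w.rho) :
    ∃ Ψ : Ω → ℝ, MeanLE P Ψ ((24 * w.rho ^ 2 + 144 * w.rho) * (Real.log (w.m + 1) + 2)) ∧
      ∀ ω σ, ∀ x ∈ V, ∀ c, w.IsSolution (observe x σ fun t => ζ t ω) c →
        ‖window (Finset.Icc w.left w.right)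
          (x - filterApply w.k c (observe x σ fun t => ζ t ω))‖ ^ 2 ≤ σ ^ 2 * Ψ ω := by
  have rho_nonneg : 0 ≤ w.rho := le_trans (by positivity) hrho
  have log_nonneg : 0 ≤ Real.log (w.m + 1) := Real.log_nonneg (by simp)
  obtain ⟨A, hA, energy_le⟩ := hζ.exists_energy_bound w (Finset.Icc w.left w.right)
  obtain ⟨G, hG, correlation_le⟩ := hζ.exists_correlation_bound rho_nonneg fun t ht =>
    LSProblem.subset_reach hm hlen ht
  obtain ⟨B, hB, projection_le⟩ := hζ.exists_projection_bound V (Finset.Icc w.left w.right)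
  obtain ⟨c₀, hc₀, hrep⟩ := hV.exists_feasible_filter hm hrho
  refine ⟨fun ω => 3 * A ω + 8 * G ω + 8 * B ω, ?_, fun ω σ x hx c hc =>
    hc.oracle_inequality hV hx hc₀ (hrep x hx) (energy_le ω) (correlation_le ω)
      (projection_le ω).2 (projection_le ω).1⟩
  have card_ratio_le_one : ((Finset.Icc w.left w.right).card : ℝ) / (w.m + 1) ≤ 1 := by
    refine div_le_one_of_le₀ ?_ (by positivity)
    have card_le : (Finset.Icc w.left w.right).card ≤ w.m + 1 := by
      rw [Int.card_Icc]
      omega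
    exact_mod_cast card_le
  have energy_mean_le : 8 * w.rho ^ 2 * ((Finset.Icc w.left w.right).card / (w.m + 1)) *
      (Real.log (w.m + 1) + 2) ≤ 8 * w.rho ^ 2 * 1 * (Real.log (w.m + 1) + 2) := by gcongr
  refine (((hA.const_mul (by norm_num : (0 : ℝ) ≤ 3)).add
    (hG.const_mul (by norm_num : (0 : ℝ) ≤ 8)) (by positivity) (by positivity)).add
    (hB.const_mul (by norm_num : (0 : ℝ) ≤ 8)) (by positivity) (by positivity)).mono ?_
  nlinarith [mul_nonneg rho_nonneg log_nonneg]

end WindowError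

section CombinedEstimator

variable {N : ℕ} {ι : Type*} {w : ι → LSProblem} {φ : (i : ι) → Signal → Fin ((w i).m + 1) → ℂ}
  {piece : Set.Icc (-(N : ℤ)) N → ι}

open Classical in
/-- The estimator whose value at a point `t` of `[-N, N]` is the output of the filter `φ i` with
`i = piece t`; outside of `[-N, N]` it vanishes. -/
noncomputable def combine (w : ι → LSProblem) (φ : (i : ι) → Signal → Fin ((w i).m + 1) → ℂ)
    (piece : Set.Icc (-(N : ℤ)) N → ι) (y : Signal) (t : ℤ) : ℂ :=
  if ht : t ∈ Set.Icc (-(N : ℤ)) N then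
    filterApply (w (piece ⟨t, ht⟩)).k (φ (piece ⟨t, ht⟩) y) y t
  else 0

lemma combine_apply (y : Signal) (t : Set.Icc (-(N : ℤ)) N) :
    combine w φ piece y t = filterApply (w (piece t)).k (φ (piece t) y) y t :=
  dif_pos t.2

lemma combinesLSFilters_combine [Fintype ι] (hw : ∀ i, (w i).Admissible N)
    (hφ : ∀ i y, (w i).IsSolution y (φ i y))
    (hpiece : ∀ t, (t : ℤ) ∈ Set.Icc (w (piece t)).left (w (piece t)).right) :
    CombinesLSFilters N (Fintype.card ι) (combine w φ piece) := by
  let e := Fintype.equivFin ι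
  refine ⟨fun j => w (e.symm j), fun t => e (piece t), fun j => φ (e.symm j), fun j => hw _,
    fun j => hφ _, fun t => ?_, fun y t => ?_⟩
  · simpa only [e.symm_apply_apply] using hpiece t
  · have value_eq : ∀ i, i = piece t →
        combine w φ piece y t = filterApply (w i).k (φ i y) y t := by
      rintro _ rfl
      exact combine_apply y t
    exact value_eq _ (e.symm_apply_apply _)

lemma isEstimator_combine (hw : ∀ i, (w i).Admissible N) (hφ : ∀ i, Measurable (φ i))
    (hφN : ∀ i y, φ i (truncate N y) = φ i y)
    (hpiece : ∀ t, (t : ℤ) ∈ Set.Icc (w (piece t)).left (w (piece t)).right) :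
    IsEstimator N (combine w φ piece) := by
  refine ⟨measurable_pi_lambda _ fun t => ?_, fun y y' hyy => funext fun t => ?_⟩
  · unfold combine
    split_ifs with ht
    · exact (continuous_filterApply _ t).measurable.comp (measurable_id.prodMk (hφ _))
    · exact measurable_const
  · unfold combine
    split_ifs with ht
    · rw [← hφN _ y, ← hφN _ y', ← (hw _).filterApply_truncate y _ (hpiece ⟨t, ht⟩),
        ← (hw _).filterApply_truncate y' _ (hpiece ⟨t, ht⟩), truncate_congr hyy]
    · rfl

lemma sum_norm_sq_sub_combine_le [Fintype ι]
    (hpiece : ∀ t, (t : ℤ) ∈ Set.Icc (w (piece t)).left (w (piece t)).right) (x y : Signal) :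
    ∑ t ∈ Finset.Icc (-(N : ℤ)) N, ‖x t - combine w φ piece y t‖ ^ 2 ≤
      ∑ i, ‖window (Finset.Icc (w i).left (w i).right)
        (x - filterApply (w i).k (φ i y) y)‖ ^ 2 := by
  classical
  let sqError (i : ι) (t : ℤ) : ℝ := ‖x t - filterApply (w i).k (φ i y) y t‖ ^ 2
  have sqError_nonneg (i : ι) (t : ℤ) : 0 ≤ sqError i t := sq_nonneg _
  let W (i : ι) := Finset.Icc (w i).left (w i).right
  have pointwise : ∀ t ∈ Finset.Icc (-(N : ℤ)) N,
      ‖x t - combine w φ piece y t‖ ^ 2 ≤ ∑ i, if t ∈ W i then sqError i t else 0 := by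
    intro t ht
    let t' : Set.Icc (-(N : ℤ)) N := ⟨t, Finset.mem_Icc.1 ht⟩
    have mem_W : t ∈ W (piece t') := Finset.mem_Icc.2 (hpiece t')
    calc ‖x t - combine w φ piece y t‖ ^ 2
        = if t ∈ W (piece t') then sqError (piece t') t else 0 := by
          rw [if_pos mem_W, show combine w φ piece y t = _ from combine_apply y t']
      _ ≤ ∑ i, if t ∈ W i then sqError i t else 0 :=
          Finset.single_le_sum (f := fun i => if t ∈ W i then sqError i t else 0)
            (fun i _ => by split_ifs <;> simp [sqError_nonneg]) (Finset.mem_univ _)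
  refine (Finset.sum_le_sum pointwise).trans ?_
  rw [Finset.sum_comm]
  refine Finset.sum_le_sum fun i _ => ?_
  rw [← Finset.sum_filter, norm_sq_window]
  exact Finset.sum_le_sum_of_subset_of_nonneg (fun t ht => (Finset.mem_filter.1 ht).2)
    fun t _ _ => sqError_nonneg i t

lemma totalMSE_le {Ω : Type*} [MeasurableSpace Ω] {P : Measure Ω} {xhat : Signal → Signal}
    {x : Signal} {σ : ℝ} {ζ : ℤ → Ω → ℂ} {Ψ : Ω → ℝ} {b : ℝ} (hΨ : MeanLE P Ψ b)
    (h : ∀ ω, ∑ t ∈ Finset.Icc (-(N : ℤ)) N,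
      ‖x t - xhat (observe x σ fun r => ζ r ω) t‖ ^ 2 ≤ Ψ ω) :
    totalMSE P N xhat x σ ζ ≤ ENNReal.ofReal b := by
  refine (lintegral_mono fun ω => ?_).trans hΨ.2
  refine le_trans (le_of_eq ?_) (ENNReal.ofReal_le_ofReal (h ω))
  rw [ENNReal.ofReal_sum_of_nonneg fun _ _ => sq_nonneg _]
  exact Finset.sum_congr rfl fun t _ => by rw [ENNReal.ofReal_pow (norm_nonneg _), ofReal_norm]

lemma IsStdComplexNoise.totalMSE_combine_le [Fintype ι] {Ω : Type*} [MeasurableSpace Ω]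
    {P : Measure Ω} [IsProbabilityMeasure P] {ζ : ℤ → Ω → ℂ} (hζ : IsStdComplexNoise P ζ)
    {V : Submodule ℂ Signal} [FiniteDimensional ℂ V] (hV : ShiftInvariant V)
    (hm : ∀ i, (w i).m = 2 * (w i).k) (hlen : ∀ i, (w i).right - (w i).left ≤ (w i).k)
    (hrho : ∀ i, 4 * Module.finrank ℂ V ≤ (w i).rho) (hφ : ∀ i y, (w i).IsSolution y (φ i y))
    (hpiece : ∀ t, (t : ℤ) ∈ Set.Icc (w (piece t)).left (w (piece t)).right)
    {x : Signal} (hx : x ∈ V) (σ : ℝ) :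
    totalMSE P N (combine w φ piece) x σ ζ ≤ ENNReal.ofReal
      (σ ^ 2 * ∑ i, (24 * (w i).rho ^ 2 + 144 * (w i).rho) * (Real.log ((w i).m + 1) + 2)) := by
  have bound_nonneg (i : ι) :
      0 ≤ (24 * (w i).rho ^ 2 + 144 * (w i).rho) * (Real.log ((w i).m + 1) + 2) := by
    have rho_nonneg : 0 ≤ (w i).rho := le_trans (by positivity) (hrho i)
    have log_nonneg : 0 ≤ Real.log ((w i).m + 1) := Real.log_nonneg (by simp)
    positivity
  choose Ψ hΨ error_le using fun i => hζ.exists_window_error_bound hV (hm i) (hlen i) (hrho i)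
  refine totalMSE_le ((MeanLE.sum Finset.univ (fun i _ => hΨ i) fun i _ => bound_nonneg i).const_mul
    (sq_nonneg σ)) fun ω => (sum_norm_sq_sub_combine_le hpiece x _).trans ?_
  rw [Finset.mul_sum]
  exact Finset.sum_le_sum fun i _ => error_le i ω σ x hx _ (hφ i _)

end CombinedEstimator

section DyadicWindows

/-- The indices of the dyadic windows: on either side of `[-N, N]`, the scales `2 ^ j ≤ N + 1`. -/
abbrev DyadicIndex (N : ℕ) : Type := Fin (Nat.log 2 (N + 1) + 1) ⊕ Fin (Nat.log 2 (N + 1) + 1)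

/-- A covering of `[-N, N]` by windows that get shorter towards the end points. The window with
index `inl j` consists of the points of `[-N, 0]` at distance between `2 ^ j` and `2 ^ (j + 1) - 1`
from `-N - 1`, so that filters supported on `[-(2 ^ j - 1), 2 ^ j - 1]` can be fitted to it;
`inr j` is its mirror image. -/
def dyadicWindow (N s : ℕ) : DyadicIndex N → LSProblem
  | .inl j => ⟨(2 ^ (j : ℕ) : ℕ) - N - 1, min (2 * (2 ^ (j : ℕ) : ℕ) - N - 2) 0,
      2 * (2 ^ (j : ℕ) - 1), 2 ^ (j : ℕ) - 1, 4 * s⟩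
  | .inr j => ⟨max (N + 2 - 2 * (2 ^ (j : ℕ) : ℕ)) 0, N + 1 - (2 ^ (j : ℕ) : ℕ),
      2 * (2 ^ (j : ℕ) - 1), 2 ^ (j : ℕ) - 1, 4 * s⟩

variable {N s : ℕ} (i : DyadicIndex N)

lemma dyadicWindow_m : (dyadicWindow N s i).m = 2 * (dyadicWindow N s i).k := by
  cases i <;> rfl

lemma dyadicWindow_rho : (dyadicWindow N s i).rho = 4 * s := by
  cases i <;> rfl

lemma dyadicWindow_right_sub_left_le :
    (dyadicWindow N s i).right - (dyadicWindow N s i).left ≤ (dyadicWindow N s i).k := by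
  rcases i with j | j <;> simp only [dyadicWindow] <;> omega

lemma dyadicWindow_admissible (hs : 1 ≤ s) : (dyadicWindow N s i).Admissible N := by
  have one_le_rho : (1 : ℝ) ≤ 4 * s := by exact_mod_cast hs.trans (by omega)
  have pow_bounds (j : Fin (Nat.log 2 (N + 1) + 1)) : 1 ≤ 2 ^ (j : ℕ) ∧ 2 ^ (j : ℕ) ≤ N + 1 :=
    ⟨Nat.one_le_two_pow,
      (Nat.pow_le_pow_right two_pos (by omega)).trans (Nat.pow_log_le_self 2 N.succ_ne_zero)⟩
  rcases i with j | j
  all_goals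
    have := pow_bounds j
    refine ⟨?_, ?_, one_le_rho, ?_, ?_⟩ <;> simp only [dyadicWindow] <;> omega

lemma exists_mem_dyadicWindow (s : ℕ) {t : ℤ} (ht : t ∈ Set.Icc (-(N : ℤ)) N) :
    ∃ i, t ∈ Set.Icc (dyadicWindow N s i).left (dyadicWindow N s i).right := by
  have abs_le : t.natAbs ≤ N := by rw [Set.mem_Icc] at ht; omega
  let j : Fin (Nat.log 2 (N + 1) + 1) :=
    ⟨Nat.log 2 (N + 1 - t.natAbs), Nat.lt_succ_of_le (Nat.log_mono_right (by omega))⟩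
  have pow_le : 2 ^ (j : ℕ) ≤ N + 1 - t.natAbs := Nat.pow_log_le_self 2 (by omega)
  have lt_pow : N + 1 - t.natAbs < 2 ^ (j : ℕ) * 2 := Nat.lt_pow_succ_log_self one_lt_two _
  rcases le_total t 0 with ht0 | ht0
  · refine ⟨.inl j, ?_⟩
    simp only [dyadicWindow, Set.mem_Icc]
    omega
  · refine ⟨.inr j, ?_⟩
    simp only [dyadicWindow, Set.mem_Icc]
    omega

lemma one_le_two_mul_log (N : ℕ) : (1 : ℝ) ≤ 2 * Real.log (N + 2) := by
  have log_two_le : Real.log 2 ≤ Real.log (N + 2) := Real.log_le_log two_pos (by simp)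
  linarith [Real.log_two_gt_d9]

lemma card_dyadicIndex_le (N : ℕ) :
    (Fintype.card (DyadicIndex N) : ℝ) ≤ 8 * Real.log (N + 2) := by
  have natLog_le : (Nat.log 2 (N + 1) : ℝ) * Real.log 2 ≤ Real.log (N + 2) := by
    rw [← Real.log_pow]
    refine Real.log_le_log (by positivity) ?_
    exact_mod_cast (Nat.pow_log_le_self 2 N.succ_ne_zero).trans N.succ.le_succ
  have := one_le_two_mul_log N
  simp only [Fintype.card_sum, Fintype.card_fin]
  push_cast
  nlinarith [Real.log_two_gt_d9, (Nat.log 2 (N + 1)).cast_nonneg (α := ℝ)]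

lemma log_dyadicWindow_m_le (hs : 1 ≤ s) :
    Real.log ((dyadicWindow N s i).m + 1) ≤ 2 * Real.log (N + 2) := by
  obtain ⟨left_le, -, -, left_ge, right_le⟩ := dyadicWindow_admissible i hs
  rw [dyadicWindow_m] at left_ge ⊢
  have k_le : (dyadicWindow N s i).k ≤ N := by omega
  have m_le : 2 * (dyadicWindow N s i).k + 1 ≤ (N + 2) ^ 2 := by nlinarith
  rw [← Nat.cast_ofNat (R := ℝ) (n := 2), ← Real.log_pow]
  exact Real.log_le_log (by positivity) (by exact_mod_cast m_le)

lemma sum_dyadicWindow_risk_le (hs : 1 ≤ s) :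
    ∑ i : DyadicIndex N, (24 * (dyadicWindow N s i).rho ^ 2 + 144 * (dyadicWindow N s i).rho) *
      (Real.log ((dyadicWindow N s i).m + 1) + 2) ≤
        46080 * (s : ℝ) ^ 2 * Real.log (N + 2) ^ 2 := by
  have one_le_log := one_le_two_mul_log N
  have one_le_s : (1 : ℝ) ≤ s := by exact_mod_cast hs
  have rho_le : 24 * (4 * s : ℝ) ^ 2 + 144 * (4 * s) ≤ 960 * s ^ 2 := by nlinarith
  have term_le (i : DyadicIndex N) :
      (24 * (dyadicWindow N s i).rho ^ 2 + 144 * (dyadicWindow N s i).rho) *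
        (Real.log ((dyadicWindow N s i).m + 1) + 2) ≤
          960 * s ^ 2 * (6 * Real.log (N + 2)) := by
    rw [dyadicWindow_rho]
    have log_nonneg : 0 ≤ Real.log ((dyadicWindow N s i).m + 1) := Real.log_nonneg (by simp)
    have log_le := log_dyadicWindow_m_le i hs
    exact mul_le_mul rho_le (by linarith) (by linarith) (by positivity)
  calc _ ≤ ∑ _i : DyadicIndex N, 960 * (s : ℝ) ^ 2 * (6 * Real.log (N + 2)) :=
        Finset.sum_le_sum fun i _ => term_le i
    _ = Fintype.card (DyadicIndex N) * (960 * (s : ℝ) ^ 2 * (6 * Real.log (N + 2))) := by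
        rw [Finset.sum_const, Finset.card_univ, nsmul_eq_mul]
    _ ≤ 8 * Real.log (N + 2) * (960 * (s : ℝ) ^ 2 * (6 * Real.log (N + 2))) :=
        mul_le_mul_of_nonneg_right (card_dyadicIndex_le N)
          (mul_nonneg (by positivity) (by linarith))
    _ = _ := by ring

end DyadicWindows

theorem mainTheorem6_general :
    ∃ C : ℝ, 0 < C ∧ ∀ N s : ℕ, 1 ≤ s →
      ∃ (J : ℕ) (xhat : Signal → Signal),
        (J : ℝ) ≤ C * Real.log (N + 2) ∧
        CombinesLSFilters N J xhat ∧
        IsEstimator N xhat ∧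
        ∀ (Ω : Type*) [MeasurableSpace Ω] (P : Measure Ω) [IsProbabilityMeasure P]
          (ζ : ℤ → Ω → ℂ), IsStdComplexNoise P ζ →
          ∀ (V : Submodule ℂ Signal) [FiniteDimensional ℂ V], ShiftInvariant V →
            Module.finrank ℂ V ≤ s → ∀ x ∈ V, ∀ σ : ℝ,
              totalMSE P N xhat x σ ζ ≤
                ENNReal.ofReal (C * σ ^ 2 * (s : ℝ) ^ 2 * Real.log (N + 2) ^ 2) := by
  refine ⟨46080, by norm_num, fun N s hs => ?_⟩
  have hadm (i : DyadicIndex N) := dyadicWindow_admissible i hs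
  choose φ hφ_meas hφ hφ_trunc using fun i => (hadm i).exists_measurable_solution
  choose piece hpiece using fun t : Set.Icc (-(N : ℤ)) N => exists_mem_dyadicWindow s t.2
  have one_le_log := one_le_two_mul_log N
  have card_le := card_dyadicIndex_le N
  refine ⟨Fintype.card (DyadicIndex N), combine (dyadicWindow N s) φ piece, by linarith,
    combinesLSFilters_combine hadm hφ hpiece, isEstimator_combine hadm hφ_meas hφ_trunc hpiece,
    fun Ω _ P _ ζ hζ V _ hV hVs x hx σ => ?_⟩
  refine (hζ.totalMSE_combine_le hV dyadicWindow_m dyadicWindow_right_sub_left_le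
    (fun i => by rw [dyadicWindow_rho]; gcongr) hφ hpiece hx σ).trans (ENNReal.ofReal_le_ofReal ?_)
  calc _ ≤ σ ^ 2 * (46080 * (s : ℝ) ^ 2 * Real.log (N + 2) ^ 2) :=
        mul_le_mul_of_nonneg_left (sum_dyadicWindow_risk_le hs) (sq_nonneg σ)
    _ = _ := by ring

theorem mainTheorem6 :
    ∃ C : ℝ, 0 < C ∧ ∀ u : ℝ, 1 < u → ∃ Cu : ℝ, 0 < Cu ∧
      ∀ N s : ℕ, 1 ≤ s →
        ∃ (J : ℕ) (xhat : Signal → Signal),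
          (J : ℝ) ≤ C * Real.log (N + 2) ∧
          CombinesLSFilters N J xhat ∧
          IsEstimator N xhat ∧
          ∀ (Ω : Type*) [MeasurableSpace Ω] (P : Measure Ω) [IsProbabilityMeasure P]
            (ζ : ℤ → Ω → ℂ), IsStdComplexNoise P ζ →
            ∀ (σ : ℝ), 0 ≤ σ → ∀ x : Signal,
              (IsGenHarmonicOscillation s x →
                totalMSE P N xhat x σ ζ ≤
                  ENNReal.ofReal (C * σ ^ 2 * (s : ℝ) ^ 3 * Real.log (N + 2) ^ 2)) ∧
              (IsSeparatedHarmonicOscillation u N s x →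
                totalMSE P N xhat x σ ζ ≤
                  ENNReal.ofReal (Cu * σ ^ 2 * (s : ℝ) ^ 2 * Real.log (N + 2) ^ 2)) := by
  obtain ⟨C, hC, general⟩ := mainTheorem6_general
  refine ⟨C, hC, fun u _ => ⟨C, hC, fun N s hs => ?_⟩⟩
  obtain ⟨J, xhat, hJ, hcomb, hest, mse_le⟩ := general N s hs
  have mse_le_of_oscillation {Ω : Type _} [MeasurableSpace Ω] {P : Measure Ω}
      [IsProbabilityMeasure P] {ζ : ℤ → Ω → ℂ} (hζ : IsStdComplexNoise P ζ) (σ : ℝ) {x : Signal}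
      (hx : IsGenHarmonicOscillation s x) : totalMSE P N xhat x σ ζ ≤
        ENNReal.ofReal (C * σ ^ 2 * (s : ℝ) ^ 2 * Real.log (N + 2) ^ 2) := by
    obtain ⟨V, _, hVs, hV, hxV⟩ := hx.exists_shiftInvariant
    exact mse_le Ω P ζ hζ V hV hVs x hxV σ
  refine ⟨J, xhat, hJ, hcomb, hest, fun Ω _ P _ ζ hζ σ _ x => ⟨fun hx => ?_, fun hx =>
    mse_le_of_oscillation hζ σ hx.isGenHarmonicOscillation⟩⟩
  refine (mse_le_of_oscillation hζ σ hx).trans (ENNReal.ofReal_le_ofReal ?_)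
  gcongr
  · exact_mod_cast hs
  · norm_num
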